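/- Let $N$ be a natural number. A domain means a nonempty connected open set, and $\mathbf C_+=\{w\in\mathbf C : \mathrm{Im}\,w>0\}$, with closure $\overline{\mathbf C_+}$ in $\mathbf C$. Put $$P=\{z\in\mathbf C^N : |z_j|<1,\ \mathrm{Im}\,z_j>0,\ j=1,\dots,N\},$$ $$R=\{z\in\mathbf C^N : |z_j|<1,\ \mathrm{Im}\,z_j=0,\ j=1,\dots,N\},$$ $$Q=\{z\in\mathbf C^N : |z_j|<1,\ j=1,\dots,N\}.$$ (i) Let $D$ be a domain in $\mathbf C^N$ containing $P$, and let $\Omega$ be a domain in $\mathbf C\times\mathbf C^N$ of the form $\Omega=\mathcal N\cap(\mathbf C_+\times D)$, where $\mathcal N$ is an open neighborhood in $\mathbf C^{1+N}$ of the set $$\bigl((\mathbf R\setminus\{0\})\times D\bigr)\cup\bigl((\overline{\mathbf C_+}\setminus\{0\})\times R\bigr).$$ Then every function holomorphic in $\Omega$ has a holomorphic extension to $\mathbf C_+\times D$. (ii) Let $D'$ be a domain in $\mathbf C^N$ containing $Q$, and let $\Omega'$ be a domain in $\mathbf C\times\mathbf C^N$ of the form $\Omega'=(\mathbf C_+\times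 Q)\cup\bigl(\mathcal N'\cap(\mathbf C_+\times D')\bigr)$, where $\mathcal N'$ is an open neighborhood in $\mathbf C^{1+N}$ of $(\mathbf R\setminus\{0\})\times D'$. Then every function holomorphic in $\Omega'$ has a holomorphic extension to $\mathbf C_+\times D'$. -/

import Mathlib

namespace AnalyticCompletion

/-- The open upper half-plane `ℂ₊`. -/
def upperHalf : Set ℂ := {w | 0 < w.im}

/-- The punctured real axis `ℝ \ {0}`, as a subset of `ℂ`. -/
def realPunctured : Set ℂ := {w | w.im = 0 ∧ w ≠ 0}

/-- A domain: an open, connected (in particular nonempty) set. -/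
def IsRegion {E : Type*} [TopologicalSpace E] (U : Set E) : Prop :=
  IsOpen U ∧ IsConnected U

/-- The upper half-polydisk `P`. -/
def halfPolydisk (N : ℕ) : Set (Fin N → ℂ) := {z | ∀ j, ‖z j‖ < 1 ∧ 0 < (z j).im}

/-- The real points of the unit polydisk. -/
def realPolydisk (N : ℕ) : Set (Fin N → ℂ) := {z | ∀ j, ‖z j‖ < 1 ∧ (z j).im = 0}

/-- The unit polydisk `Q`. -/
def unitPolydisk (N : ℕ) : Set (Fin N → ℂ) := {z | ∀ j, ‖z j‖ < 1}

/-- Every function holomorphic in `Ω` has a holomorphic extension in `U`. -/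
def HolomorphicallyExtends {E : Type*} [NormedAddCommGroup E] [NormedSpace ℂ E]
    (Ω U : Set E) : Prop :=
  Ω ⊆ U ∧ ∀ f : E → ℂ, DifferentiableOn ℂ f Ω →
    ∃ g : E → ℂ, DifferentiableOn ℂ g U ∧ Set.EqOn g f Ω

end AnalyticCompletion

/-!
Functions holomorphic near the punctured real axis are extended over `ℂ₊ × D` in two stages.

*Propagation in `z`.* Let `f` be holomorphic near `(ℝ \ {0}) × ball z₀ R` inside `ℂ₊ × E`, and let
`F` be holomorphic on `ℂ₊ × ball z₀ ρ` with `ρ < R`, equal to `f` near the real axis. Expand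
`F (w, ·)` at `z₀` in homogeneous polynomials. Their coefficients are holomorphic in `w`; they
satisfy the Cauchy estimates of the ball of radius `R` for `w` near compact parts of `ℝ \ {0}` and
those of the ball of radius `ρ` elsewhere. The points `0` and `∞` have harmonic measure zero, so the
maximum principle gives the estimates of radius `R` for all `w ∈ ℂ₊`. Concretely, `z - z₀` is
rescaled by `exp (-δ φ w)`, where `φ = w ^ (1/4) + w ^ (-1/4)` has a real part tending to infinity at
`0` and `∞`; then the rescaled function extends to the large ball outside a compact subset of `ℂ₊`,
the Hartogs-type lemma `differentiableOn_taylorSum` applies, and `δ → 0`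
(`exists_extension_ball`). Connectedness of `D` turns an extension over any nonempty open
subset into one over `D` (`exists_extension_of_isPreconnected`). When `Ω` contains `ℂ₊ × Q`, this is
already the whole proof, the polydisk `Q` being the open subset to start from.

*The wedge.* When instead `Ω` contains only the points of `ℂ₊ × P` near `ℂ₊ × R`, with `P` the upper
half-polydisk and `R` the real points of the polydisk, an extension over a small box in `P` is
needed first. For each `w` it is given by continuation of `f (w, ·)` along the rays
`Re z + i s Im z`, `0 < s ≤ 1`, which start where `f` is defined. That this continuation exists and
is holomorphic follows by sweeping out the box with the analytic discs `w ↦ x + i (τ - δ φ w) y`: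
the part of such a disc over `δ Re φ < τ` has its frontier either at real `w ≠ 0` or at real points
`z`, near both of which `f` is known. Raising `τ` in small steps, the Hartogs-type lemma is applied
in a tube around the disc at each step (`disc_mem_rayRegular`).
-/

namespace AnalyticCompletion

open Filter Topology Metric Set

/-! ### Differentiation of circle integrals with parameters -/

theorem differentiableAt_circleIntegral_param {H : Type*} [NormedAddCommGroup H]
    [NormedSpace ℂ H] [FiniteDimensional ℂ H] {Φ : H × ℂ → ℂ} {p₀ : H} {s : ℝ} (hs : 0 < s)
    (hΦ : ∀ l ∈ sphere (0 : ℂ) s, ∀ᶠ q in 𝓝 (p₀, l), DifferentiableAt ℂ Φ q) :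
    DifferentiableAt ℂ (fun p => ∮ l in C(0, s), Φ (p, l)) p₀ := by
  have : ProperSpace H := FiniteDimensional.proper ℂ H
  set X : Set (H × ℂ) := {q | ∀ᶠ q' in 𝓝 q, DifferentiableAt ℂ Φ q'}
  have hX : IsOpen X := isOpen_setOfPred_eventually_nhds
  have hXd : ∀ q ∈ X, DifferentiableAt ℂ Φ q := fun q hq => Eventually.self_of_nhds hq
  have hK : IsCompact (({p₀} : Set H) ×ˢ sphere (0 : ℂ) s) :=
    isCompact_singleton.prod (isCompact_sphere _ _)
  have hKX : (({p₀} : Set H) ×ˢ sphere (0 : ℂ) s) ⊆ X := by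
    rintro ⟨p, l⟩ ⟨hp, hl⟩
    rw [mem_singleton_iff] at hp
    subst hp
    exact hΦ l hl
  obtain ⟨ε, hε, hεX⟩ := hK.exists_cthickening_subset_open hX hKX
  obtain ⟨M, hM⟩ := (hK.cthickening (r := ε)).exists_bound_of_continuousOn
    (f := Φ) (fun q hq => (hXd q (hεX hq)).continuousAt.continuousWithinAt)
  have hmem : ∀ p ∈ ball p₀ ε, ∀ l ∈ sphere (0 : ℂ) s,
      (p, l) ∈ cthickening ε (({p₀} : Set H) ×ˢ sphere (0 : ℂ) s) := by
    intro p hp l hl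
    refine mem_cthickening_of_dist_le (p, l) (p₀, l) ε _ ⟨rfl, hl⟩ ?_
    rw [Prod.dist_eq]
    simpa [hε.le] using (mem_ball.1 hp).le
  have hM0 : 0 ≤ M := (norm_nonneg _).trans
    (hM _ (hmem p₀ (mem_ball_self hε) s (by simp [abs_of_pos hs])))
  have hcm : ∀ t, circleMap 0 s t ∈ sphere (0 : ℂ) s := fun t => circleMap_mem_sphere _ hs.le t
  have hdp : ∀ p ∈ ball p₀ ε, ∀ t,
      DifferentiableAt ℂ (fun p => Φ (p, circleMap 0 s t)) p := fun p hp t =>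
    DifferentiableAt.comp p (hXd _ (hεX (hmem p hp _ (hcm t))))
      (differentiableAt_id.prodMk (differentiableAt_const _))
  have hcont : ∀ p ∈ ball p₀ ε,
      Continuous fun t => deriv (circleMap 0 s) t • Φ (p, circleMap 0 s t) := by
    intro p hp
    refine Continuous.smul (f := fun t => deriv (circleMap 0 s) t)
      (g := fun t => Φ (p, circleMap 0 s t)) ?_ ?_
    · simp only [deriv_circleMap]
      fun_prop
    · rw [continuous_iff_continuousAt]
      intro t
      exact ContinuousAt.comp (f := fun t => (p, circleMap 0 s t))
        (hXd _ (hεX (hmem p hp _ (hcm t)))).continuousAt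
        (Continuous.continuousAt (by fun_prop))
  refine HasFDerivAt.differentiableAt (f' := ∫ t in (0 : ℝ)..2 * Real.pi,
    deriv (circleMap 0 s) t • fderiv ℂ (fun p => Φ (p, circleMap 0 s t)) p₀)
    (intervalIntegral.hasFDerivAt_integral_of_dominated_of_fderiv_le
      (F := fun p t => deriv (circleMap 0 s) t • Φ (p, circleMap 0 s t))
      (F' := fun p t => deriv (circleMap 0 s) t • fderiv ℂ (fun p => Φ (p, circleMap 0 s t)) p)
      (bound := fun _ => s * (2 * M / (ε / 2)))
      (s := ball p₀ (ε / 2)) (ball_mem_nhds _ (by positivity)) ?_ ?_ ?_ ?_ ?_ ?_)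
  · filter_upwards [ball_mem_nhds p₀ hε] with p hp
    exact (hcont p hp).aestronglyMeasurable
  · exact (hcont p₀ (mem_ball_self hε)).intervalIntegrable _ _
  · borelize H
    refine MeasureTheory.AEStronglyMeasurable.smul
      (f := fun t => deriv (circleMap 0 s) t) ?_ ?_
    · refine Continuous.aestronglyMeasurable ?_
      simp only [deriv_circleMap]
      fun_prop
    · have hEq : (fun t => fderiv ℂ (fun p => Φ (p, circleMap 0 s t)) p₀) =
          fun t => (fderiv ℂ Φ (p₀, circleMap 0 s t)).comp (ContinuousLinearMap.inl ℂ H ℂ) := by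
        funext t
        have h1 := (hXd _ (hεX (hmem p₀ (mem_ball_self hε) _ (hcm t)))).hasFDerivAt
        have h2 : HasFDerivAt (fun p : H => (p, circleMap 0 s t))
            (ContinuousLinearMap.inl ℂ H ℂ) p₀ := hasFDerivAt_prodMk_left _ _
        exact (HasFDerivAt.comp p₀ h1 h2).fderiv
      rw [hEq]
      have hm : Measurable fun t => fderiv ℂ Φ (p₀, circleMap 0 s t) :=
        (measurable_fderiv ℂ Φ).comp (Continuous.measurable (by fun_prop))
      exact Continuous.comp_aestronglyMeasurable
        (g := fun L : H × ℂ →L[ℂ] ℂ => L.comp (ContinuousLinearMap.inl ℂ H ℂ))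
        (by fun_prop) hm.aestronglyMeasurable
  · refine Eventually.of_forall fun t _ p hp => ?_
    have hsub : ball p (ε / 2) ⊆ ball p₀ ε := by
      refine ball_subset_ball' ?_
      linarith [mem_ball.1 hp]
    rw [norm_smul]
    have h1 : ‖deriv (circleMap 0 s) t‖ = s := by simp [deriv_circleMap, abs_of_pos hs]
    rw [h1]
    refine mul_le_mul_of_nonneg_left ?_ hs.le
    refine Complex.norm_fderiv_le_div_of_mapsTo_ball
      (fun q hq => (hdp q (hsub hq) t).differentiableWithinAt) ?_ (by positivity)
    intro q hq
    rw [mem_closedBall, dist_eq_norm]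
    refine (norm_sub_le _ _).trans ?_
    have := hM _ (hmem q (hsub hq) _ (hcm t))
    have := hM _ (hmem p (hsub (mem_ball_self (by positivity))) _ (hcm t))
    linarith
  · exact intervalIntegrable_const
  · refine Eventually.of_forall fun t _ p hp => ?_
    have hp' : p ∈ ball p₀ ε := ball_subset_ball (by linarith) hp
    exact ((hdp p hp' t).hasFDerivAt).fun_const_smul _

/-! ### Homogeneous expansions -/

section Taylor

variable {E : Type*} [NormedAddCommGroup E] [NormedSpace ℂ E]

/-- The degree `k` homogeneous part at `v` of the Taylor expansion of `φ` at the origin. It is read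
off the one-variable function `l ↦ φ (l • v)`, so that only the germ of `φ` at `0` matters. -/
noncomputable def homCoeff (φ : E → ℂ) (k : ℕ) (v : E) : ℂ :=
  (k.factorial : ℂ)⁻¹ * iteratedDeriv k (fun l : ℂ => φ (l • v)) 0

/-- The sum of the homogeneous expansion of `φ` at the origin (junk where it diverges). -/
noncomputable def taylorSum (φ : E → ℂ) (v : E) : ℂ := ∑' k, homCoeff φ k v

theorem homCoeff_congr {φ χ : E → ℂ} (h : φ =ᶠ[𝓝 0] χ) (k : ℕ) (v : E) :
    homCoeff φ k v = homCoeff χ k v := by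
  unfold homCoeff
  congr 1
  refine Filter.EventuallyEq.iteratedDeriv_eq k ?_
  have : Tendsto (fun l : ℂ => l • v) (𝓝 0) (𝓝 0) := by
    have h : Continuous fun l : ℂ => l • v := by fun_prop
    simpa using h.tendsto 0
  exact this.eventually h

theorem taylorSum_comp_smul (φ : E → ℂ) (c : ℂ) (v : E) :
    taylorSum (fun u => φ (c • u)) v = taylorSum φ (c • v) := by
  unfold taylorSum homCoeff
  simp only [smul_comm c]

theorem differentiableOn_slice {φ : E → ℂ} {r r' : ℝ} (hφ : DifferentiableOn ℂ φ (ball 0 r))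
    {v : E} (h : ∀ l ∈ ball (0 : ℂ) r', ‖l • v‖ < r) :
    DifferentiableOn ℂ (fun l : ℂ => φ (l • v)) (ball 0 r') := by
  refine hφ.comp (Differentiable.differentiableOn (by fun_prop)) ?_
  intro l hl
  simpa using h l hl

theorem taylorSum_eq {φ χ : E → ℂ} {r : ℝ} (h : φ =ᶠ[𝓝 0] χ)
    (hχ : DifferentiableOn ℂ χ (ball 0 r)) {v : E} (hv : ‖v‖ < r) :
    taylorSum φ v = χ v := by
  have h1 : taylorSum φ v = taylorSum χ v := by
    unfold taylorSum
    exact tsum_congr fun k => homCoeff_congr h k v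
  rw [h1]
  obtain ⟨r', hr', hv'⟩ : ∃ r' : ℝ, 1 < r' ∧ r' * ‖v‖ < r := by
    have : Tendsto (fun x : ℝ => x * ‖v‖) (𝓝[>] 1) (𝓝 (1 * ‖v‖)) :=
      (Continuous.tendsto (by fun_prop) 1).mono_left nhdsWithin_le_nhds
    obtain ⟨x, hx, hx'⟩ := ((this.eventually (gt_mem_nhds (by simpa using hv))).and
      self_mem_nhdsWithin).exists
    exact ⟨x, hx', hx⟩
  have hd : DifferentiableOn ℂ (fun l : ℂ => χ (l • v)) (ball 0 r') := by
    refine differentiableOn_slice hχ fun l hl => ?_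
    rw [norm_smul]
    refine lt_of_le_of_lt (mul_le_mul_of_nonneg_right ?_ (norm_nonneg v)) hv'
    simpa using (mem_ball.1 hl).le
  have := Complex.taylorSeries_eq_on_ball' (c := 0) (r := r') (z := 1) (by simpa using hr') hd
  simpa [taylorSum, homCoeff] using this

theorem norm_homCoeff_le {φ : E → ℂ} {r M : ℝ} (hr : 0 < r)
    (hφ : DifferentiableOn ℂ φ (closedBall 0 r)) (hM : ∀ u ∈ closedBall (0 : E) r, ‖φ u‖ ≤ M)
    (k : ℕ) (v : E) : ‖homCoeff φ k v‖ ≤ M * (‖v‖ / r) ^ k := by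
  rcases eq_or_ne v 0 with rfl | hv
  · have h0 : ‖φ 0‖ ≤ M := hM 0 (by simp [hr.le])
    unfold homCoeff
    cases k with
    | zero => simpa using h0
    | succ k => simp [iteratedDeriv_const]
  · have hv' : 0 < ‖v‖ := norm_pos_iff.2 hv
    have hmaps : ∀ l ∈ closedBall (0 : ℂ) (r / ‖v‖), l • v ∈ closedBall (0 : E) r := by
      intro l hl
      rw [mem_closedBall_zero_iff] at hl ⊢
      rw [norm_smul]
      exact (le_div_iff₀ hv').1 hl
    have hd : DifferentiableOn ℂ (fun l : ℂ => φ (l • v)) (closedBall 0 (r / ‖v‖)) :=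
      hφ.comp (Differentiable.differentiableOn (by fun_prop)) hmaps
    have := Complex.norm_iteratedDeriv_le_of_forall_mem_sphere_norm_le (C := M) k
      (div_pos hr hv') ((hd.mono closure_ball_subset_closedBall).diffContOnCl)
      (fun l hl => hM _ (hmaps l (sphere_subset_closedBall hl)))
    unfold homCoeff
    rw [norm_mul, norm_inv, Complex.norm_natCast]
    have hk : (0 : ℝ) < k.factorial := by positivity
    rw [inv_mul_le_iff₀ hk]
    refine this.trans (le_of_eq ?_)
    rw [div_pow, div_pow]
    field_simp

variable [FiniteDimensional ℂ E]

/-- The homogeneous parts of a holomorphic function of `(w, v)`, expanded in `v`, are holomorphic in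
all variables: locally they are Cauchy integrals over a small circle. -/
theorem differentiableAt_homCoeff {F : ℂ × E → ℂ} {X : Set (ℂ × E)} (hX : IsOpen X)
    (hF : DifferentiableOn ℂ F X) {w₀ : ℂ} (hw : (w₀, (0 : E)) ∈ X) (k : ℕ) (v₀ : E) :
    DifferentiableAt ℂ (fun p : ℂ × E => homCoeff (fun u => F (p.1, u)) k p.2) (w₀, v₀) := by
  -- a circle so small that the disc it bounds, in the direction of `v₀`, stays inside `X`
  obtain ⟨s, hs, hsX⟩ : ∃ s : ℝ, 0 < s ∧ ∀ l ∈ closedBall (0 : ℂ) s, (w₀, l • v₀) ∈ X := by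
    have hc : Continuous fun l : ℂ => (w₀, l • v₀) := by fun_prop
    have : ∀ᶠ l in 𝓝 (0 : ℂ), (w₀, l • v₀) ∈ X :=
      hc.continuousAt.eventually (hX.mem_nhds (by simpa using hw))
    obtain ⟨s, hs, h⟩ := nhds_basis_closedBall.eventually_iff.1 this
    exact ⟨s, hs, fun l hl => h hl⟩
  have hcont : Continuous fun q : (ℂ × E) × ℂ => (q.1.1, q.2 • q.1.2) := by fun_prop
  have hev : ∀ᶠ p in 𝓝 (w₀, v₀), ∀ l ∈ closedBall (0 : ℂ) s, (p.1, l • p.2) ∈ X := by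
    refine (isCompact_closedBall (0 : ℂ) s).eventually_forall_of_forall_eventually
      fun l hl => ?_
    exact hcont.continuousAt.eventually (hX.mem_nhds (hsX l hl))
  have hcauchy : (fun p : ℂ × E => homCoeff (fun u => F (p.1, u)) k p.2) =ᶠ[𝓝 (w₀, v₀)]
      fun p => (2 * Real.pi * Complex.I)⁻¹ *
        ∮ l in C(0, s), (1 / l ^ (k + 1)) * F (p.1, l • p.2) := by
    filter_upwards [hev] with p hp
    have hd : DifferentiableOn ℂ (fun l : ℂ => F (p.1, l • p.2)) (closedBall 0 s) :=
      hF.comp (Differentiable.differentiableOn (by fun_prop)) hp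
    have := hd.circleIntegral_one_div_sub_center_pow_smul hs k
    simp only [sub_zero, smul_eq_mul] at this
    rw [this]
    unfold homCoeff
    have h2 : (2 * Real.pi * Complex.I : ℂ) ≠ 0 := Complex.two_pi_I_ne_zero
    have h3 : (k.factorial : ℂ) ≠ 0 := by exact_mod_cast k.factorial_ne_zero
    field_simp
  refine DifferentiableAt.congr_of_eventuallyEq ?_ hcauchy
  refine DifferentiableAt.const_mul ?_ _
  refine differentiableAt_circleIntegral_param
    (Φ := fun q : (ℂ × E) × ℂ => (1 / q.2 ^ (k + 1)) * F (q.1.1, q.2 • q.1.2)) hs ?_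
  intro l hl
  have hl0 : l ≠ 0 := by
    rintro rfl
    simp at hl
    exact hs.ne hl
  have e1 : ∀ᶠ q in 𝓝 ((w₀, v₀), l), (q.1.1, q.2 • q.1.2) ∈ X :=
    hcont.continuousAt.eventually (hX.mem_nhds (hsX l (sphere_subset_closedBall hl)))
  have e2 : ∀ᶠ q : (ℂ × E) × ℂ in 𝓝 ((w₀, v₀), l), q.2 ≠ 0 :=
    continuous_snd.continuousAt.eventually_ne hl0
  filter_upwards [e1, e2] with q hq1 hq2
  refine DifferentiableAt.mul ?_ ?_
  · simp only [one_div]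
    exact DifferentiableAt.inv (by fun_prop) (pow_ne_zero _ hq2)
  · exact DifferentiableAt.comp (f := fun q : (ℂ × E) × ℂ => (q.1.1, q.2 • q.1.2)) q
      (hF.differentiableAt (hX.mem_nhds hq1)) (by fun_prop)

end Taylor

/-! ### Enlarging the ball of convergence by the maximum principle -/

section Hartogs

variable {E : Type*} [NormedAddCommGroup E] [NormedSpace ℂ E] [FiniteDimensional ℂ E]

theorem exists_nhds_norm_homCoeff_le {F g : ℂ × E → ℂ} {w : ℂ} {A : Set ℂ} (hA : A ∈ 𝓝 w)
    {r r' : ℝ} (hr' : 0 < r') (hr : r' < r) (hg : DifferentiableOn ℂ g (A ×ˢ ball 0 r))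
    (hgF : g =ᶠ[𝓝 (w, 0)] F) :
    ∃ B ∈ 𝓝 w, ∃ M, ∀ w' ∈ B, ∀ k (v : E),
      ‖homCoeff (fun u => F (w', u)) k v‖ ≤ M * (‖v‖ / r') ^ k := by
  have : ProperSpace E := FiniteDimensional.proper ℂ E
  obtain ⟨s, hs, hsA⟩ := nhds_basis_closedBall.mem_iff.1 hA
  have hK : IsCompact (closedBall w s ×ˢ closedBall (0 : E) r') :=
    (isCompact_closedBall _ _).prod (isCompact_closedBall _ _)
  have hsub : closedBall w s ×ˢ closedBall (0 : E) r' ⊆ A ×ˢ ball 0 r :=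
    prod_mono hsA (closedBall_subset_ball hr)
  obtain ⟨M, hM⟩ := hK.exists_bound_of_continuousOn (hg.continuousOn.mono hsub)
  have hev : ∀ᶠ w' in 𝓝 w, ∀ᶠ v in 𝓝 (0 : E), g (w', v) = F (w', v) := by
    rw [EventuallyEq, nhds_prod_eq] at hgF
    exact hgF.curry
  refine ⟨closedBall w s ∩ {w' | ∀ᶠ v in 𝓝 (0 : E), g (w', v) = F (w', v)},
    inter_mem (closedBall_mem_nhds _ hs) hev, M, ?_⟩
  rintro w' ⟨hw', hgF'⟩ k v
  rw [← homCoeff_congr (φ := fun u => g (w', u)) hgF']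
  refine norm_homCoeff_le hr' ?_ (fun u hu => hM (w', u) ⟨hw', hu⟩) k v
  refine hg.comp (Differentiable.differentiableOn (by fun_prop)) fun u hu => hsub ⟨hw', hu⟩

/-- Near every point of `U` the homogeneous parts obey the Cauchy estimates of the large ball: they
do so near the frontier of a relatively compact open set containing `C`, and the maximum principle
in `w` carries the estimate inside. -/
theorem exists_nhds_norm_homCoeff_le_of_compact {U C : Set ℂ} (hU : IsOpen U) (hC : IsCompact C)
    (hCU : C ⊆ U) {F : ℂ × E → ℂ} {X : Set (ℂ × E)} (hX : IsOpen X) (hF : DifferentiableOn ℂ F X)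
    (hUX : ∀ w ∈ U, (w, (0 : E)) ∈ X) {r : ℝ}
    (hext : ∀ w ∈ U \ C, ∃ A ∈ 𝓝 w, ∃ g : ℂ × E → ℂ,
      DifferentiableOn ℂ g (A ×ˢ ball 0 r) ∧ g =ᶠ[𝓝 (w, 0)] F)
    {r' : ℝ} (hr' : 0 < r') (hr : r' < r) {w₀ : ℂ} (hw₀ : w₀ ∈ U) :
    ∃ B ∈ 𝓝 w₀, ∃ M, ∀ w' ∈ B, ∀ k (v : E),
      ‖homCoeff (fun u => F (w', u)) k v‖ ≤ M * (‖v‖ / r') ^ k := by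
  obtain ⟨C', hC', hCC', hC'U⟩ := exists_compact_between (hC.insert w₀) hU
    (insert_subset hw₀ hCU)
  set G := interior C'
  have hGC' : G ⊆ C' := interior_subset
  have hfr : frontier G ⊆ C' \ G := by
    rw [isOpen_interior.frontier_eq]
    exact sdiff_subset_sdiff_left (closure_minimal hGC' hC'.isClosed)
  have hfrc : IsCompact (frontier G) :=
    hC'.of_isClosed_subset isClosed_frontier fun w hw => (hfr hw).1
  have hbound : ∃ M, ∀ w' ∈ frontier G, ∀ k (v : E),
      ‖homCoeff (fun u => F (w', u)) k v‖ ≤ M * (‖v‖ / r') ^ k := by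
    refine hfrc.induction_on
      (p := fun S => ∃ M, ∀ w' ∈ S, ∀ k (v : E),
        ‖homCoeff (fun u => F (w', u)) k v‖ ≤ M * (‖v‖ / r') ^ k) ?_ ?_ ?_ ?_
    · exact ⟨0, fun w' hw' => hw'.elim⟩
    · rintro S T hST ⟨M, hM⟩
      exact ⟨M, fun w' hw' => hM w' (hST hw')⟩
    · rintro S T ⟨M, hM⟩ ⟨M', hM'⟩
      refine ⟨max M M', ?_⟩
      rintro w' (hw' | hw') k v
      · exact (hM w' hw' k v).trans (by gcongr; exact le_max_left _ _)
      · exact (hM' w' hw' k v).trans (by gcongr; exact le_max_right _ _)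
    · intro w hw
      have hwU : w ∈ U \ C :=
        ⟨hC'U (hfr hw).1, fun h => (hfr hw).2 (hCC' (mem_insert_of_mem _ h))⟩
      obtain ⟨A, hA, g, hg, hgF⟩ := hext w hwU
      obtain ⟨B, hB, hM⟩ := exists_nhds_norm_homCoeff_le hA hr' hr hg hgF
      exact ⟨B, mem_nhdsWithin_of_mem_nhds hB, hM⟩
  obtain ⟨M, hM⟩ := hbound
  have hGw₀ : w₀ ∈ G := hCC' (mem_insert _ _)
  refine ⟨G, isOpen_interior.mem_nhds hGw₀, M, fun w' hw' k v => ?_⟩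
  have hd : DifferentiableOn ℂ (fun w => homCoeff (fun u => F (w, u)) k v) U := fun w hw =>
    (DifferentiableAt.comp (f := fun w : ℂ => (w, v)) w
      (differentiableAt_homCoeff hX hF (hUX w hw) k v) (by fun_prop)).differentiableWithinAt
  have hclU : closure G ⊆ U := (closure_minimal hGC' hC'.isClosed).trans hC'U
  exact Complex.norm_le_of_forall_mem_frontier_norm_le (hC'.isBounded.subset hGC')
    (hd.mono hclU).diffContOnCl (fun w hw => hM w hw k v) (subset_closure hw')

/-- A Hartogs-type lemma. If `F` is holomorphic near `U × {0}` and extends to balls of radius `r` in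
the second variable near each point of `U` outside a compact subset, then its expansion in the
second variable converges to a holomorphic function on all of `U × ball 0 r`. -/
theorem differentiableOn_taylorSum {U C : Set ℂ} (hU : IsOpen U) (hC : IsCompact C)
    (hCU : C ⊆ U) {F : ℂ × E → ℂ} {X : Set (ℂ × E)} (hX : IsOpen X) (hF : DifferentiableOn ℂ F X)
    (hUX : ∀ w ∈ U, (w, (0 : E)) ∈ X) {r : ℝ}
    (hext : ∀ w ∈ U \ C, ∃ A ∈ 𝓝 w, ∃ g : ℂ × E → ℂ,
      DifferentiableOn ℂ g (A ×ˢ ball 0 r) ∧ g =ᶠ[𝓝 (w, 0)] F) :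
    DifferentiableOn ℂ (fun p : ℂ × E => taylorSum (fun u => F (p.1, u)) p.2)
      (U ×ˢ ball 0 r) := by
  rintro ⟨w₀, v₀⟩ ⟨hw₀, hv₀⟩
  refine DifferentiableAt.differentiableWithinAt ?_
  obtain ⟨r₁, hv₁, hr₁⟩ := exists_between (mem_ball_zero_iff.1 hv₀)
  obtain ⟨r', hr₁', hr'⟩ := exists_between hr₁
  have hr₁0 : 0 < r₁ := (norm_nonneg _).trans_lt hv₁
  obtain ⟨B, hB, M, hM⟩ := exists_nhds_norm_homCoeff_le_of_compact hU hC hCU hX hF hUX hext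
    (hr₁0.trans hr₁') hr' hw₀
  have hN : (U ∩ B) ×ˢ ball (0 : E) r₁ ∈ 𝓝 (w₀, v₀) :=
    prod_mem_nhds (inter_mem (hU.mem_nhds hw₀) hB)
      (isOpen_ball.mem_nhds (mem_ball_zero_iff.2 hv₁))
  obtain ⟨ε, hε, hεN⟩ := Metric.mem_nhds_iff.1 hN
  have hM0 : 0 ≤ M := by
    have := (norm_nonneg _).trans (hM w₀ (mem_of_mem_nhds hB) 0 v₀)
    simpa using this
  set q := r₁ / r'
  have hq0 : 0 ≤ q := div_nonneg hr₁0.le (hr₁0.trans hr₁').le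
  have hq1 : q < 1 := (div_lt_one (hr₁0.trans hr₁')).2 hr₁'
  set a : ℕ → ℂ × E → ℂ := fun k p => homCoeff (fun u => F (p.1, u)) k p.2
  have ha : ∀ k, ∀ p ∈ ball (w₀, v₀) ε, ‖a k p‖ ≤ M * q ^ k := by
    intro k p hp
    obtain ⟨⟨-, hpB⟩, hpv⟩ := hεN hp
    refine (hM p.1 hpB k p.2).trans ?_
    have : ‖p.2‖ ≤ r₁ := (mem_ball_zero_iff.1 hpv).le
    have : 0 < r' := hr₁0.trans hr₁'
    gcongr
    exact div_le_div_of_nonneg_right ‹_› this.le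
  have had : ∀ k, ∀ p ∈ ball (w₀, v₀) ε, DifferentiableAt ℂ (a k) p := fun k p hp =>
    differentiableAt_homCoeff hX hF (hUX _ (hεN hp).1.1) k p.2
  have hsum : Summable fun k : ℕ => M * q ^ k :=
    (summable_geometric_of_lt_one hq0 hq1).mul_left M
  have hhalf : (w₀, v₀) ∈ ball (w₀, v₀) (ε / 2) := mem_ball_self (by positivity)
  refine (hasFDerivAt_tsum_of_isPreconnected (𝕜 := ℂ) (f := a) (f' := fun k p => fderiv ℂ (a k) p)
    (u := fun k => 2 * (M * q ^ k) / (ε / 2)) (s := ball (w₀, v₀) (ε / 2)) ?_ isOpen_ball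
    (convex_ball _ _).isPreconnected ?_ ?_ hhalf ?_ hhalf).differentiableAt
  · exact (hsum.mul_left 2).div_const _
  · exact fun k p hp => (had k p (ball_subset_ball (by linarith) hp)).hasFDerivAt
  · intro k p hp
    have hsub : ball p (ε / 2) ⊆ ball (w₀, v₀) ε := by
      refine ball_subset_ball' ?_
      linarith [mem_ball.1 hp]
    refine Complex.norm_fderiv_le_div_of_mapsTo_ball
      (fun p' hp' => (had k p' (hsub hp')).differentiableWithinAt) ?_ (by positivity)
    intro p' hp'
    rw [mem_closedBall, dist_eq_norm]
    refine (norm_sub_le _ _).trans ?_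
    linarith [ha k p' (hsub hp'), ha k p (hsub (mem_ball_self (by positivity)))]
  · exact Summable.of_norm_bounded hsum fun k => ha k _ (mem_ball_self hε)

end Hartogs

/-! ### A barrier at the two exceptional boundary points -/

theorem isOpen_upperHalf : IsOpen upperHalf := isOpen_lt continuous_const Complex.continuous_im

theorem convex_upperHalf : Convex ℝ upperHalf := convex_halfSpace_im_gt 0

/-- There is a holomorphic function on the upper half-plane whose real part dominates its imaginary
part and tends to infinity at `0` and at `∞`; the one used is `w ^ (1/4) + w ^ (-1/4)`. The bound on
the imaginary part keeps the discs `disc` below bounded in the real directions. -/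
theorem exists_barrier : ∃ φ : ℂ → ℂ, DifferentiableOn ℂ φ upperHalf ∧
    (∀ w ∈ upperHalf, |(φ w).im| ≤ (φ w).re) ∧
    ∀ M : ℝ, ∃ a b : ℝ, 0 < a ∧ a < b ∧ ∀ w ∈ upperHalf, (φ w).re ≤ M → a ≤ ‖w‖ ∧ ‖w‖ ≤ b := by
  have key : ∀ w ∈ upperHalf, ∃ t : ℝ, 0 < t ∧ t < Real.pi / 4 ∧
      (Complex.exp (Complex.log w / 4) + Complex.exp (-(Complex.log w / 4))).re =
        (Real.exp (Real.log ‖w‖ / 4) + Real.exp (-(Real.log ‖w‖ / 4))) * Real.cos t ∧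
      (Complex.exp (Complex.log w / 4) + Complex.exp (-(Complex.log w / 4))).im =
        (Real.exp (Real.log ‖w‖ / 4) - Real.exp (-(Real.log ‖w‖ / 4))) * Real.sin t := by
    intro w hw
    have hw' : 0 < w.im := hw
    have h4 : Complex.log w / 4 = ((Real.log ‖w‖ / 4 : ℝ) : ℂ) + ((w.arg / 4 : ℝ) : ℂ) * Complex.I := by
      rw [Complex.log]
      push_cast
      ring
    have h4re : (Complex.log w / 4).re = Real.log ‖w‖ / 4 := by rw [h4]; simp
    have h4im : (Complex.log w / 4).im = w.arg / 4 := by rw [h4]; simp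
    have harg : 0 < w.arg := by
      rcases (Complex.arg_nonneg_iff.2 hw'.le).lt_or_eq with h | h
      · exact h
      · have := (Complex.arg_eq_zero_iff.1 h.symm).2
        exact absurd this hw'.ne'
    have harg' : w.arg < Real.pi := by
      rcases (Complex.arg_le_pi w).lt_or_eq with h | h
      · exact h
      · exact absurd (Complex.arg_eq_pi_iff.1 h).2 hw'.ne'
    refine ⟨w.arg / 4, by positivity, by linarith, ?_, ?_⟩
    · rw [Complex.add_re, Complex.exp_re, Complex.exp_re, Complex.neg_re, Complex.neg_im, h4re,
        h4im, Real.cos_neg]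
      ring
    · rw [Complex.add_im, Complex.exp_im, Complex.exp_im, Complex.neg_re, Complex.neg_im, h4re,
        h4im, Real.sin_neg]
      ring
  refine ⟨fun w => Complex.exp (Complex.log w / 4) + Complex.exp (-(Complex.log w / 4)), ?_, ?_, ?_⟩
  · intro w hw
    have : w ∈ Complex.slitPlane := Or.inr (ne_of_gt hw)
    have hl := (Complex.differentiableAt_log this)
    exact (DifferentiableAt.add (hl.div_const 4).cexp
      (hl.div_const 4).neg.cexp).differentiableWithinAt
  · intro w hw
    obtain ⟨t, ht0, ht1, hre, him⟩ := key w hw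
    have hpi := Real.pi_pos
    have hs : 0 ≤ Real.sin t := Real.sin_nonneg_of_nonneg_of_le_pi ht0.le (by linarith)
    have hsc : Real.sin t ≤ Real.cos t := by
      rw [← Real.sin_pi_div_two_sub]
      exact Real.sin_le_sin_of_le_of_le_pi_div_two (by linarith) (by linarith) (by linarith)
    have e1 := Real.exp_pos (Real.log ‖w‖ / 4)
    have e2 := Real.exp_pos (-(Real.log ‖w‖ / 4))
    simp only [hre, him]
    rw [abs_mul, abs_of_nonneg hs]
    refine mul_le_mul ?_ hsc hs (by positivity)
    rw [abs_le]
    constructor <;> linarith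
  · intro M
    refine ⟨Real.exp (-(4 * (2 * |M|) + 1)), Real.exp (4 * (2 * |M|) + 1), Real.exp_pos _, ?_, ?_⟩
    · apply Real.exp_lt_exp.2
      linarith [abs_nonneg M]
    intro w hw hM
    obtain ⟨t, ht0, ht1, hre, -⟩ := key w hw
    have hw0 : 0 < ‖w‖ := by
      rw [norm_pos_iff]
      rintro rfl
      simp [upperHalf] at hw
    have hc : 1 / 2 ≤ Real.cos t := by
      rw [← Real.cos_pi_div_three]
      exact Real.cos_le_cos_of_nonneg_of_le_pi ht0.le (by linarith [Real.pi_pos])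
        (by linarith [Real.pi_pos])
    simp only [hre] at hM
    have e1 := Real.exp_pos (Real.log ‖w‖ / 4)
    have e2 := Real.exp_pos (-(Real.log ‖w‖ / 4))
    have e3 := Real.add_one_le_exp (Real.log ‖w‖ / 4)
    have e4 := Real.add_one_le_exp (-(Real.log ‖w‖ / 4))
    have e5 : Real.exp (Real.log ‖w‖ / 4) + Real.exp (-(Real.log ‖w‖ / 4)) ≤ 2 * |M| := by
      have := le_abs_self M
      nlinarith
    constructor
    · rw [← Real.le_log_iff_exp_le hw0]
      linarith
    · rw [← Real.log_le_iff_le_exp hw0]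
      linarith

/-! ### Behaviour near the punctured real axis -/

section NearReal

variable {E : Type*} [NormedAddCommGroup E]

/-- `Ω` contains all points of `ℂ₊ × E` that are close enough to `(ℝ \ {0}) × S`. -/
def CoversNearReal (Ω : Set (ℂ × E)) (S : Set E) : Prop :=
  ∀ x ∈ realPunctured, ∀ z ∈ S, ∀ᶠ p in 𝓝 (x, z), p.1 ∈ upperHalf → p ∈ Ω

/-- `F` and `f` coincide at all points of `ℂ₊ × E` that are close enough to `(ℝ \ {0}) × S`. -/
def AgreeNearReal (F f : ℂ × E → ℂ) (S : Set E) : Prop :=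
  ∀ x ∈ realPunctured, ∀ z ∈ S, ∀ᶠ p in 𝓝 (x, z), p.1 ∈ upperHalf → F p = f p

theorem AgreeNearReal.mono {F f : ℂ × E → ℂ} {S T : Set E} (h : AgreeNearReal F f T)
    (hST : S ⊆ T) : AgreeNearReal F f S := fun x hx z hz => h x hx z (hST hz)

/-- A property of germs at `(ℝ \ {0}) × Z` holds uniformly near compact pieces. -/
theorem exists_uniform_near_real {Z : Set E} (hZ : IsCompact Z) {a b : ℝ} (ha : 0 < a)
    {P : ℂ × E → Prop} (hP : ∀ x ∈ realPunctured, ∀ z ∈ Z, ∀ᶠ p in 𝓝 (x, z), P p) :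
    ∃ κ > 0, ∀ w : ℂ, a ≤ ‖w‖ → ‖w‖ ≤ b → |w.im| < κ → ∀ z, ∀ z' ∈ Z, dist z z' < κ →
      P (w, z) := by
  set K : Set ℂ := closedBall 0 b ∩ {w | w.im = 0 ∧ a / 2 ≤ ‖w‖}
  have hK : IsCompact K := by
    refine (isCompact_closedBall _ _).inter_right ?_
    exact (isClosed_eq Complex.continuous_im continuous_const).inter
      (isClosed_le continuous_const continuous_norm)
  have hX : IsOpen {q : ℂ × E | ∀ᶠ p in 𝓝 q, P p} := isOpen_setOfPred_eventually_nhds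
  have hKX : K ×ˢ Z ⊆ {q : ℂ × E | ∀ᶠ p in 𝓝 q, P p} := by
    rintro ⟨x, z⟩ ⟨⟨-, hx0, hx⟩, hz⟩
    refine hP x ⟨hx0, ?_⟩ z hz
    rintro rfl
    simp at hx
    linarith
  obtain ⟨δ, hδ, hδX⟩ := (hK.prod hZ).exists_thickening_subset_open hX hKX
  refine ⟨min δ (a / 2), by positivity, fun w hwa hwb hw z z' hz' hzz' => ?_⟩
  have hmem : (w, z) ∈ thickening δ (K ×ˢ Z) := by
    rw [mem_thickening_iff]
    refine ⟨((w.re : ℂ), z'), ⟨⟨?_, ?_, ?_⟩, hz'⟩, ?_⟩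
    · rw [mem_closedBall_zero_iff, Complex.norm_real]
      exact (Complex.abs_re_le_norm w).trans hwb
    · simp
    · rw [Complex.norm_real, Real.norm_eq_abs]
      have := Complex.norm_le_abs_re_add_abs_im w
      have := hw.trans_le (min_le_right _ _)
      linarith
    · rw [Prod.dist_eq, max_lt_iff]
      refine ⟨?_, hzz'.trans_le (min_le_left _ _)⟩
      have h1 : w - (w.re : ℂ) = (w.im : ℂ) * Complex.I := by
        apply Complex.ext <;> simp
      have h2 : ‖w - (w.re : ℂ)‖ = |w.im| := by rw [h1]; simp
      change dist w (w.re : ℂ) < δ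
      rw [dist_eq_norm, h2]
      exact hw.trans_le (min_le_left _ _)
  have := hδX hmem
  exact Eventually.self_of_nhds this

/-- Holomorphic functions on `ℂ₊ × S` are determined, over each `z`, by their germs near the
punctured real axis. -/
theorem AgreeNearReal.eq_of_mem [NormedSpace ℂ E] {F G f : ℂ × E → ℂ} {S T : Set E}
    (hF : DifferentiableOn ℂ F (upperHalf ×ˢ S)) (hG : DifferentiableOn ℂ G (upperHalf ×ˢ T))
    (hFf : AgreeNearReal F f S) (hGf : AgreeNearReal G f T) {w : ℂ} (hw : w ∈ upperHalf) {z : E}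
    (hzS : z ∈ S) (hzT : z ∈ T) : F (w, z) = G (w, z) := by
  have h1 : (1 : ℂ) ∈ realPunctured := ⟨by simp, one_ne_zero⟩
  have hc : Continuous fun w : ℂ => (w, z) := by fun_prop
  have hev : ∀ᶠ w in 𝓝 (1 : ℂ), w ∈ upperHalf → F (w, z) = G (w, z) := by
    filter_upwards [hc.continuousAt.eventually (hFf 1 h1 z hzS),
      hc.continuousAt.eventually (hGf 1 h1 z hzT)] with w hw1 hw2 hw
    exact (hw1 hw).trans (hw2 hw).symm
  obtain ⟨w₀, hw₀, hw₀'⟩ : ∃ w₀ ∈ upperHalf, ∀ᶠ w in 𝓝 w₀, F (w, z) = G (w, z) := by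
    have ht : Tendsto (fun t : ℝ => (1 : ℂ) + t * Complex.I) (𝓝[>] 0) (𝓝 1) := by
      have : Continuous fun t : ℝ => (1 : ℂ) + t * Complex.I := by fun_prop
      simpa using (this.tendsto 0).mono_left nhdsWithin_le_nhds
    obtain ⟨t, ht1, ht2⟩ := ((ht.eventually hev.eventually_nhds).and
      self_mem_nhdsWithin).exists
    have hU : (1 : ℂ) + t * Complex.I ∈ upperHalf := by
      simpa [upperHalf] using ht2
    refine ⟨_, hU, ?_⟩
    filter_upwards [ht1, isOpen_upperHalf.mem_nhds hU] with w hw hw'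
    exact hw hw'
  have hFz : AnalyticOnNhd ℂ (fun w => F (w, z)) upperHalf :=
    (hF.comp (Differentiable.differentiableOn (by fun_prop))
      fun w hw => ⟨hw, hzS⟩).analyticOnNhd isOpen_upperHalf
  have hGz : AnalyticOnNhd ℂ (fun w => G (w, z)) upperHalf :=
    (hG.comp (Differentiable.differentiableOn (by fun_prop))
      fun w hw => ⟨hw, hzT⟩).analyticOnNhd isOpen_upperHalf
  exact hFz.eqOn_of_preconnected_of_eventuallyEq hGz convex_upperHalf.isPreconnected hw₀ hw₀' hw

end NearReal

/-! ### Propagation of the extension over a connected set -/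

section Propagation

variable {E : Type*} [NormedAddCommGroup E] [NormedSpace ℂ E] [FiniteDimensional ℂ E]

/-- If `f` is holomorphic near the punctured real axis over a ball and extends to all `w ∈ ℂ₊` over
a smaller concentric ball, then it extends over the whole ball. The radius of convergence over `w`
is controlled by that on the real axis because the points `0` and `∞` are negligible for the
maximum principle: rescaling by `exp (-δ φ)`, with `φ` the barrier, makes the rescaled function
extend to the large ball for `w` near `0` and `∞` as well, and `δ` is arbitrarily small. -/
theorem exists_extension_ball {Ω : Set (ℂ × E)} {f F : ℂ × E → ℂ} (hf : DifferentiableOn ℂ f Ω)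
    {z₀ : E} {ρ R : ℝ} (hρ : 0 < ρ) (hΩ : CoversNearReal Ω (ball z₀ R))
    (hF : DifferentiableOn ℂ F (upperHalf ×ˢ ball z₀ ρ)) (hFf : AgreeNearReal F f (ball z₀ ρ)) :
    ∃ G : ℂ × E → ℂ, DifferentiableOn ℂ G (upperHalf ×ˢ ball z₀ R) ∧
      AgreeNearReal G f (ball z₀ R) := by
  have : ProperSpace E := FiniteDimensional.proper ℂ E
  -- compact pieces of the punctured axis carry, uniformly, the ball of any radius below `R`
  have hnear : ∀ r, 0 < r → r < R → ∀ a b : ℝ, 0 < a → ∃ κ > 0, ∀ w ∈ upperHalf,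
      a ≤ ‖w‖ → ‖w‖ ≤ b → w.im < κ → (∀ z ∈ ball z₀ r, (w, z) ∈ Ω) ∧
        ∀ z, dist z z₀ < κ → F (w, z) = f (w, z) := by
    intro r hr hrR a b ha
    obtain ⟨κ₁, hκ₁, h1⟩ := exists_uniform_near_real (isCompact_closedBall z₀ r) (b := b) ha
      (P := fun p => p.1 ∈ upperHalf → p ∈ Ω)
      (fun x hx z hz => hΩ x hx z (closedBall_subset_ball hrR hz))
    obtain ⟨κ₂, hκ₂, h2⟩ := exists_uniform_near_real (isCompact_singleton (x := z₀)) (b := b) ha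
      (P := fun p => p.1 ∈ upperHalf → F p = f p)
      (fun x hx z hz => hFf x hx z (by rw [mem_singleton_iff.1 hz]; exact mem_ball_self hρ))
    refine ⟨min κ₁ κ₂, lt_min hκ₁ hκ₂, fun w hw hwa hwb hwi => ⟨fun z hz => ?_, fun z hz => ?_⟩⟩
    · refine h1 w hwa hwb ?_ z z (ball_subset_closedBall hz) (by simpa using hκ₁) hw
      rw [abs_of_pos hw]
      exact hwi.trans_le (min_le_left _ _)
    · refine h2 w hwa hwb ?_ z z₀ rfl (hz.trans_le (min_le_right _ _)) hw
      rw [abs_of_pos hw]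
      exact hwi.trans_le (min_le_right _ _)
  obtain ⟨φ, hφd, hφi, hφ⟩ := exists_barrier
  have hφ0 : ∀ w ∈ upperHalf, 0 ≤ (φ w).re := fun w hw => (abs_nonneg _).trans (hφi w hw)
  refine ⟨fun p => taylorSum (fun u => F (p.1, z₀ + u)) (p.2 - z₀), ?_, ?_⟩
  · rintro ⟨w₁, z₁⟩ ⟨hw₁, hz₁⟩
    refine DifferentiableAt.differentiableWithinAt ?_
    obtain ⟨r, hr₁, hrR⟩ := exists_between (mem_ball_iff_norm.1 hz₁)
    have hr : 0 < r := (norm_nonneg _).trans_lt hr₁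
    obtain ⟨δ, hδ, hδr⟩ : ∃ δ : ℝ, 0 < δ ∧ Real.exp (δ * (φ w₁).re) * ‖z₁ - z₀‖ < r := by
      have hc : Continuous fun δ : ℝ => Real.exp (δ * (φ w₁).re) * ‖z₁ - z₀‖ := by fun_prop
      have ht := (hc.tendsto 0).mono_left (nhdsWithin_le_nhds (s := Ioi 0))
      obtain ⟨δ, h1, h2⟩ := ((ht.eventually (gt_mem_nhds (by simpa using hr₁))).and
        self_mem_nhdsWithin).exists
      exact ⟨δ, h2, h1⟩
    -- the rescaled function
    set σ : ℂ → ℂ := fun w => Complex.exp (-(δ * φ w))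
    have hσd : DifferentiableOn ℂ σ upperHalf := (hφd.const_mul (δ : ℂ)).neg.cexp
    have hσn : ∀ w, ‖σ w‖ = Real.exp (-(δ * (φ w).re)) := fun w => by
      simp [σ, Complex.norm_exp]
    have hσ1 : ∀ w ∈ upperHalf, ‖σ w‖ ≤ 1 := fun w hw => by
      rw [hσn, Real.exp_le_one_iff]
      have := mul_nonneg hδ.le (hφ0 w hw)
      linarith
    have hTd : DifferentiableOn ℂ (fun p : ℂ × E => (p.1, z₀ + σ p.1 • p.2))
        (upperHalf ×ˢ univ) := by
      refine DifferentiableOn.prodMk differentiableOn_fst (DifferentiableOn.const_add _ ?_)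
      exact (hσd.comp differentiableOn_fst fun p hp => hp.1).smul differentiableOn_snd
    have hUo : IsOpen (upperHalf ×ˢ (univ : Set E)) := isOpen_upperHalf.prod isOpen_univ
    set X : Set (ℂ × E) := (upperHalf ×ˢ univ) ∩
      (fun p : ℂ × E => (p.1, z₀ + σ p.1 • p.2)) ⁻¹' (upperHalf ×ˢ ball z₀ ρ)
    have hX : IsOpen X := hTd.continuousOn.isOpen_inter_preimage hUo
      (isOpen_upperHalf.prod isOpen_ball)
    have hFX : DifferentiableOn ℂ (fun p : ℂ × E => F (p.1, z₀ + σ p.1 • p.2)) X :=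
      hF.comp (hTd.mono inter_subset_left) fun p hp => hp.2
    set M := -Real.log (ρ / r) / δ
    have hM : ∀ w, M < (φ w).re → ‖σ w‖ * r < ρ := by
      intro w hw
      rw [hσn, ← lt_div_iff₀ hr, ← Real.lt_log_iff_exp_lt (by positivity)]
      have := (div_lt_iff₀ hδ).1 hw
      linarith
    obtain ⟨a, b, ha, hab, hφM⟩ := hφ M
    obtain ⟨κ, hκ, hnr⟩ := hnear r hr hrR (a / 2) (2 * b) (by positivity)
    set C : Set ℂ := closedBall 0 b ∩ {w | κ ≤ w.im}
    have hC : IsCompact C := (isCompact_closedBall _ _).inter_right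
      (isClosed_le continuous_const Complex.continuous_im)
    have hCU : C ⊆ upperHalf := fun w hw => lt_of_lt_of_le hκ hw.2
    have hT := differentiableOn_taylorSum isOpen_upperHalf hC hCU hX hFX
      (fun w hw => ⟨⟨hw, mem_univ _⟩, ⟨hw, by simpa using hρ⟩⟩) (r := r) ?_
    · have hcomp : (fun p : ℂ × E => taylorSum (fun u => F (p.1, z₀ + u)) (p.2 - z₀)) =
          (fun p : ℂ × E => taylorSum (fun u => F (p.1, z₀ + σ p.1 • u)) p.2) ∘
            fun p : ℂ × E => (p.1, Complex.exp (δ * φ p.1) • (p.2 - z₀)) := by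
        funext p
        have := taylorSum_comp_smul (fun u => F (p.1, z₀ + u)) (σ p.1)
          (Complex.exp (δ * φ p.1) • (p.2 - z₀))
        simp only [Function.comp]
        rw [this, smul_smul, ← Complex.exp_add]
        simp
      rw [hcomp]
      refine DifferentiableAt.comp _ (hT.differentiableAt
        ((isOpen_upperHalf.prod isOpen_ball).mem_nhds ⟨hw₁, ?_⟩)) ?_
      · rw [mem_ball_zero_iff, norm_smul, Complex.norm_exp]
        simpa using hδr
      · refine differentiableAt_fst.prodMk (DifferentiableAt.smul ?_ ?_)
        · have hd : DifferentiableAt ℂ φ w₁ :=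
            hφd.differentiableAt (isOpen_upperHalf.mem_nhds hw₁)
          exact ((DifferentiableAt.comp (f := Prod.fst) (w₁, z₁) hd
            differentiableAt_fst).const_mul _).cexp
        · exact differentiableAt_snd.sub_const _
    · rintro w ⟨hw, hwC⟩
      by_cases hwM : M < (φ w).re
      · refine ⟨upperHalf ∩ {w | M < (φ w).re}, ?_, _, hFX.mono ?_, EventuallyEq.rfl⟩
        · have hre : ContinuousOn (fun w => (φ w).re) upperHalf :=
            Complex.continuous_re.comp_continuousOn hφd.continuousOn
          exact (hre.isOpen_inter_preimage isOpen_upperHalf isOpen_Ioi).mem_nhds ⟨hw, hwM⟩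
        · rintro ⟨w', v⟩ ⟨⟨hw', hwM'⟩, hv⟩
          refine ⟨⟨hw', mem_univ _⟩, hw', ?_⟩
          simp only [mem_ball, dist_self_add_left]
          rw [norm_smul]
          exact (mul_le_mul_of_nonneg_left (mem_ball_zero_iff.1 hv).le (norm_nonneg _)).trans_lt
            (hM _ hwM')
      · obtain ⟨hwa, hwb⟩ := hφM w hw (not_lt.1 hwM)
        have hwκ : w.im < κ := by
          by_contra h
          exact hwC ⟨mem_closedBall_zero_iff.2 hwb, not_lt.1 h⟩
        set A : Set ℂ := upperHalf ∩ {w | w.im < κ ∧ a / 2 < ‖w‖ ∧ ‖w‖ < 2 * b}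
        have hA : A ∈ 𝓝 w := by
          refine inter_mem (isOpen_upperHalf.mem_nhds hw) ?_
          have e1 : ∀ᶠ w' in 𝓝 w, Complex.im w' < κ :=
            Complex.continuous_im.continuousAt.eventually (gt_mem_nhds hwκ)
          have e2 : ∀ᶠ w' in 𝓝 w, a / 2 < ‖w'‖ :=
            continuous_norm.continuousAt.eventually (lt_mem_nhds (by linarith))
          have e3 : ∀ᶠ w' in 𝓝 w, ‖w'‖ < 2 * b :=
            continuous_norm.continuousAt.eventually (gt_mem_nhds (by linarith))
          filter_upwards [e1, e2, e3] with w' h1 h2 h3 using ⟨h1, h2, h3⟩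
        have hAn := fun w' (hw' : w' ∈ A) =>
          hnr w' hw'.1 hw'.2.2.1.le hw'.2.2.2.le hw'.2.1
        refine ⟨A, hA, fun p : ℂ × E => f (p.1, z₀ + σ p.1 • p.2), ?_, ?_⟩
        · refine hf.comp (hTd.mono (prod_mono inter_subset_left (subset_univ _))) ?_
          rintro ⟨w', v⟩ ⟨hw', hv⟩
          refine (hAn w' hw').1 _ ?_
          simp only [mem_ball, dist_self_add_left]
          rw [norm_smul]
          refine lt_of_le_of_lt ?_ (mem_ball_zero_iff.1 hv)
          exact mul_le_of_le_one_left (norm_nonneg _) (hσ1 w' hw'.1)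
        · have hball : A ×ˢ ball (0 : E) κ ∈ 𝓝 (w, (0 : E)) :=
            prod_mem_nhds hA (ball_mem_nhds _ hκ)
          filter_upwards [hball] with p hp
          refine ((hAn p.1 hp.1).2 _ ?_).symm
          rw [dist_self_add_left, norm_smul]
          refine lt_of_le_of_lt ?_ (mem_ball_zero_iff.1 hp.2)
          exact mul_le_of_le_one_left (norm_nonneg _) (hσ1 _ hp.1.1)
  · intro x hx z hz
    obtain ⟨r, hr₁, hrR⟩ := exists_between (mem_ball_iff_norm.1 hz)
    have hr : 0 < r := (norm_nonneg _).trans_lt hr₁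
    have hx0 : 0 < ‖x‖ := norm_pos_iff.2 hx.2
    obtain ⟨κ, hκ, hnr⟩ := hnear r hr hrR (‖x‖ / 2) (2 * ‖x‖) (by positivity)
    have e1 : ∀ᶠ p : ℂ × E in 𝓝 (x, z), p.1.im < κ :=
      (Complex.continuous_im.comp continuous_fst).continuousAt.eventually
        (gt_mem_nhds (by simpa [hx.1] using hκ))
    have e2 : ∀ᶠ p : ℂ × E in 𝓝 (x, z), ‖x‖ / 2 < ‖p.1‖ :=
      (continuous_norm.comp continuous_fst).continuousAt.eventually
        (lt_mem_nhds (by simpa using hx0))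
    have e3 : ∀ᶠ p : ℂ × E in 𝓝 (x, z), ‖p.1‖ < 2 * ‖x‖ :=
      (continuous_norm.comp continuous_fst).continuousAt.eventually
        (gt_mem_nhds (by simp only [Function.comp]; linarith))
    have e4 : ∀ᶠ p : ℂ × E in 𝓝 (x, z), p.2 ∈ ball z₀ r :=
      continuous_snd.continuousAt.eventually
        (isOpen_ball.mem_nhds (mem_ball_iff_norm.2 hr₁))
    filter_upwards [e1, e2, e3, e4] with p h1 h2 h3 h4 hp
    obtain ⟨hpΩ, hpF⟩ := hnr p.1 hp h2.le h3.le h1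
    have := taylorSum_eq (φ := fun u => F (p.1, z₀ + u)) (χ := fun u => f (p.1, z₀ + u))
      (r := r) (v := p.2 - z₀) ?_ ?_ (mem_ball_iff_norm.1 h4)
    · simpa using this
    · filter_upwards [ball_mem_nhds (0 : E) hκ] with u hu
      exact hpF _ (by simpa using hu)
    · refine hf.comp (Differentiable.differentiableOn (by fun_prop)) fun u hu => ?_
      exact hpΩ _ (by simpa using hu)

/-- An extension over a nonempty open part of a connected open set `D` propagates to all of `D`. -/
theorem exists_extension_of_isPreconnected {Ω : Set (ℂ × E)} {f F : ℂ × E → ℂ}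
    (hf : DifferentiableOn ℂ f Ω) {D V : Set E} (hD : IsOpen D) (hDc : IsPreconnected D)
    (hΩ : CoversNearReal Ω D) (hV : IsOpen V) (hVne : V.Nonempty) (hVD : V ⊆ D)
    (hF : DifferentiableOn ℂ F (upperHalf ×ˢ V)) (hFf : AgreeNearReal F f V) :
    ∃ G : ℂ × E → ℂ, DifferentiableOn ℂ G (upperHalf ×ˢ D) ∧ AgreeNearReal G f D := by
  set S : Set E := {z | ∃ r > 0, ∃ G : ℂ × E → ℂ,
    DifferentiableOn ℂ G (upperHalf ×ˢ ball z r) ∧ AgreeNearReal G f (ball z r)}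
  have hS : IsOpen S := by
    rw [Metric.isOpen_iff]
    rintro z ⟨r, hr, G, hG, hGf⟩
    refine ⟨r / 2, by positivity, fun z' hz' => ⟨r / 2, by positivity, G, ?_⟩⟩
    have hsub : ball z' (r / 2) ⊆ ball z r := ball_subset_ball' (by linarith [mem_ball.1 hz'])
    exact ⟨hG.mono (prod_mono_right hsub), hGf.mono hsub⟩
  have hDS : D ⊆ S := by
    refine hDc.subset_of_closure_inter_subset hS ?_ ?_
    · obtain ⟨z, hz⟩ := hVne
      obtain ⟨r, hr, hrV⟩ := Metric.isOpen_iff.1 hV z hz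
      exact ⟨z, hVD hz, r, hr, F, hF.mono (prod_mono_right hrV), hFf.mono hrV⟩
    · rintro z₁ ⟨hz₁, hz₁D⟩
      obtain ⟨r, hr, hrD⟩ := Metric.isOpen_iff.1 hD z₁ hz₁D
      obtain ⟨z₀, ⟨ρ, hρ, G, hG, hGf⟩, hz₀⟩ := Metric.mem_closure_iff.1 hz₁ (r / 4) (by positivity)
      have hsub : ball z₀ (r / 2) ⊆ D :=
        (ball_subset_ball' (by rw [dist_comm]; linarith)).trans hrD
      obtain ⟨G', hG', hG'f⟩ := exists_extension_ball hf hρ (R := r / 2)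
        (fun x hx z hz => hΩ x hx z (hsub hz)) hG hGf
      have hsub' : ball z₁ (r / 4) ⊆ ball z₀ (r / 2) := ball_subset_ball' (by linarith)
      exact ⟨r / 4, by positivity, G', hG'.mono (prod_mono_right hsub'), hG'f.mono hsub'⟩
  have hDS' : ∀ z ∈ D, ∃ G : ℂ × E → ℂ, ∃ r > 0,
      DifferentiableOn ℂ G (upperHalf ×ˢ ball z r) ∧ AgreeNearReal G f (ball z r) := by
    intro z hz
    obtain ⟨r, hr, G, hG, hGf⟩ := hDS hz
    exact ⟨G, r, hr, hG, hGf⟩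
  choose! G r hr hG hGf using hDS'
  refine ⟨fun p => G p.2 p, ?_, ?_⟩
  all_goals
    have hloc : ∀ z₀ ∈ D, ∀ᶠ z in 𝓝 z₀, ∀ w ∈ upperHalf, G z (w, z) = G z₀ (w, z) := by
      intro z₀ hz₀
      filter_upwards [hD.mem_nhds hz₀, ball_mem_nhds z₀ (hr z₀ hz₀)] with z hzD hz w hw
      exact AgreeNearReal.eq_of_mem (hG z hzD) (hG z₀ hz₀) (hGf z hzD) (hGf z₀ hz₀) hw
        (mem_ball_self (hr z hzD)) hz
  · rintro ⟨w₀, z₀⟩ ⟨hw₀, hz₀⟩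
    refine DifferentiableAt.differentiableWithinAt ?_
    refine ((hG z₀ hz₀).differentiableAt ((isOpen_upperHalf.prod isOpen_ball).mem_nhds
      ⟨hw₀, mem_ball_self (hr z₀ hz₀)⟩)).congr_of_eventuallyEq ?_
    filter_upwards [continuous_snd.continuousAt.eventually (hloc z₀ hz₀),
      continuous_fst.continuousAt.eventually (isOpen_upperHalf.mem_nhds hw₀)] with p hp hp'
    exact hp p.1 hp'
  · intro x hx z₀ hz₀
    filter_upwards [continuous_snd.continuousAt.eventually (hloc z₀ hz₀),
      hGf z₀ hz₀ x hx z₀ (mem_ball_self (hr z₀ hz₀))] with p hp hp' hpU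
    exact (hp p.1 hpU).trans (hp' hpU)

end Propagation

/-! ### Continuation along rays towards the real points -/

section Rays

variable {N : ℕ}

/-- The point obtained from `z` by keeping its real part and multiplying its imaginary part by `l`;
real `l ∈ (0, 1]` sweep out the segment from `Re z` (excluded) to `z`. -/
def ray (z : Fin N → ℂ) (l : ℂ) : Fin N → ℂ :=
  fun j => ((z j).re : ℂ) + l * ((z j).im : ℂ) * Complex.I

theorem ray_re (z : Fin N → ℂ) (s : ℝ) (j : Fin N) : (ray z s j).re = (z j).re := by
  simp [ray]

theorem ray_im (z : Fin N → ℂ) (s : ℝ) (j : Fin N) : (ray z s j).im = s * (z j).im := by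
  simp [ray]

theorem ray_one (z : Fin N → ℂ) : ray z 1 = z := by
  funext j
  simp [ray, Complex.re_add_im]

theorem ray_ray (z : Fin N → ℂ) (s t : ℝ) : ray (ray z s) t = ray z ((s * t : ℝ) : ℂ) := by
  funext j
  apply Complex.ext
  · rw [ray_re, ray_re, ray_re]
  · rw [ray_im, ray_im, ray_im]
    ring

theorem continuous_ray : Continuous fun p : (Fin N → ℂ) × ℂ => ray p.1 p.2 := by
  unfold ray
  refine continuous_pi fun j => ?_
  have h1 : Continuous fun p : (Fin N → ℂ) × ℂ => p.1 j := by fun_prop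
  have h2 : Continuous fun p : (Fin N → ℂ) × ℂ => ((p.1 j).re : ℂ) :=
    Complex.continuous_ofReal.comp (Complex.continuous_re.comp h1)
  have h3 : Continuous fun p : (Fin N → ℂ) × ℂ => ((p.1 j).im : ℂ) :=
    Complex.continuous_ofReal.comp (Complex.continuous_im.comp h1)
  exact h2.add ((continuous_snd.mul h3).mul continuous_const)

theorem analyticAt_comp_ray {g : (Fin N → ℂ) → ℂ} {S : Set (Fin N → ℂ)} (hS : IsOpen S)
    (hg : DifferentiableOn ℂ g S) {z : Fin N → ℂ} {s : ℝ} (hs : ray z s ∈ S) :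
    AnalyticAt ℝ (fun t : ℝ => g (ray z t)) s := by
  have hd : Differentiable ℂ (ray z) := by
    unfold ray
    fun_prop
  have ho : IsOpen (ray z ⁻¹' S) := hS.preimage hd.continuous
  have h1 : AnalyticAt ℂ (fun l => g (ray z l)) (s : ℂ) :=
    (hg.comp hd.differentiableOn (mapsTo_preimage _ _)).analyticAt (ho.mem_nhds hs)
  exact AnalyticAt.fun_comp (f := fun t : ℝ => (t : ℂ)) (x := s) h1.restrictScalars
    (Complex.ofRealCLM.analyticAt s)

/-- `c` is the value at `p = (w, z)` of the continuation of `f (w, ·)` along the segment from `Re z`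
to `z`: the restriction of `f` to the initial part of this segment has a real-analytic continuation
to all of it, with value `c` at the end. -/
def Continues (f : ℂ × (Fin N → ℂ) → ℂ) (p : ℂ × (Fin N → ℂ)) (c : ℂ) : Prop :=
  ∃ γ : ℝ → ℂ, AnalyticOnNhd ℝ γ (Ioc 0 1) ∧
    (∀ᶠ s : ℝ in 𝓝[>] 0, γ s = f (p.1, ray p.2 s)) ∧ γ 1 = c

theorem Continues.unique {f : ℂ × (Fin N → ℂ) → ℂ} {p : ℂ × (Fin N → ℂ)} {c c' : ℂ}
    (h : Continues f p c) (h' : Continues f p c') : c = c' := by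
  obtain ⟨γ, hγ, hγf, rfl⟩ := h
  obtain ⟨γ', hγ', hγf', rfl⟩ := h'
  have hev : ∀ᶠ s in 𝓝[>] (0 : ℝ), γ s = γ' s := by
    filter_upwards [hγf, hγf'] with s h h' using h.trans h'.symm
  obtain ⟨a, ha, hev⟩ := mem_nhdsGT_iff_exists_Ioo_subset.1 hev
  have ha' : (0 : ℝ) < a := ha
  obtain ⟨s, hs0, hs⟩ := exists_between (lt_min ha' one_pos)
  have hsa := hs.trans_le (min_le_left _ _)
  have hs1 := hs.trans_le (min_le_right _ _)
  refine hγ.eqOn_of_preconnected_of_eventuallyEq hγ' isPreconnected_Ioc ⟨hs0, hs1.le⟩ ?_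
    (right_mem_Ioc.2 one_pos)
  filter_upwards [Ioo_mem_nhds hs0 hsa] with t ht using hev ht

theorem continues_along {f : ℂ × (Fin N → ℂ) → ℂ} {w : ℂ} {z : Fin N → ℂ} {γ : ℝ → ℂ}
    (hγ : AnalyticOnNhd ℝ γ (Ioc 0 1)) (hγf : ∀ᶠ s : ℝ in 𝓝[>] 0, γ s = f (w, ray z s))
    {s : ℝ} (hs : 0 < s) (hs1 : s ≤ 1) : Continues f (w, ray z s) (γ s) := by
  refine ⟨fun t => γ (s * t), ?_, ?_, by simp⟩
  · intro t ht
    have hst : s * t ∈ Ioc (0 : ℝ) 1 :=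
      ⟨mul_pos hs ht.1, mul_le_one₀ hs1 ht.1.le ht.2⟩
    exact AnalyticAt.fun_comp (f := fun t : ℝ => s * t) (hγ _ hst)
      (analyticAt_const.mul analyticAt_id)
  · have ht : Tendsto (fun t : ℝ => s * t) (𝓝[>] 0) (𝓝[>] 0) := by
      refine tendsto_nhdsWithin_iff.2 ⟨?_, ?_⟩
      · have : Continuous fun t : ℝ => s * t := by fun_prop
        simpa using (this.tendsto 0).mono_left nhdsWithin_le_nhds
      · filter_upwards [self_mem_nhdsWithin] with t ht using mul_pos hs ht
    filter_upwards [ht.eventually hγf] with t ht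
    rw [ht, ray_ray]

/-- Concatenation: a continuation up to the parameter `s₀` can be prolonged by an analytic function
that gives the continuation near some `s₁ < s₀`. -/
theorem Continues.concat {f : ℂ × (Fin N → ℂ) → ℂ} {w : ℂ} {z : Fin N → ℂ} {c : ℂ} {s₀ s₁ : ℝ}
    (hs₁ : 0 < s₁) (h₁₀ : s₁ < s₀) (hs₀ : s₀ ≤ 1) (h : Continues f (w, ray z s₀) c)
    {g : ℝ → ℂ} (hg : AnalyticOnNhd ℝ g (Icc s₁ 1))
    (hgf : ∀ᶠ s : ℝ in 𝓝 s₁, Continues f (w, ray z s) (g s)) : Continues f (w, z) (g 1) := by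
  obtain ⟨γ, hγ, hγf, -⟩ := h
  have hs₀0 : 0 < s₀ := hs₁.trans h₁₀
  have hEq : ∀ᶠ s in 𝓝 s₁, γ (s / s₀) = g s := by
    filter_upwards [hgf, Ioo_mem_nhds hs₁ h₁₀] with s hs hs'
    have := continues_along hγ hγf (s := s / s₀) (div_pos hs'.1 hs₀0)
      ((div_le_one hs₀0).2 hs'.2.le)
    rw [ray_ray, mul_div_cancel₀ _ hs₀0.ne'] at this
    exact this.unique hs
  have hγ' : ∀ s, 0 < s → s ≤ s₀ → AnalyticAt ℝ (fun s => γ (s / s₀)) s := fun s hs hs' =>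
    AnalyticAt.fun_comp (f := fun s : ℝ => s / s₀)
      (hγ _ ⟨div_pos hs hs₀0, (div_le_one hs₀0).2 hs'⟩) (analyticAt_id.div_const)
  refine ⟨fun s => if s < s₁ then γ (s / s₀) else g s, ?_, ?_, ?_⟩
  · intro s hs
    rcases lt_trichotomy s s₁ with hlt | rfl | hgt
    · refine (hγ' s hs.1 (hlt.trans h₁₀).le).congr ?_
      filter_upwards [gt_mem_nhds hlt] with t ht
      rw [if_pos ht]
    · refine (hg s ⟨le_rfl, hs.2⟩).congr ?_
      filter_upwards [hEq] with t ht
      split_ifs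
      · exact ht.symm
      · rfl
    · refine (hg s ⟨hgt.le, hs.2⟩).congr ?_
      filter_upwards [lt_mem_nhds hgt] with t ht
      rw [if_neg (not_lt.2 (le_of_lt ht))]
  · have ht : Tendsto (fun t : ℝ => t / s₀) (𝓝[>] 0) (𝓝[>] 0) := by
      refine tendsto_nhdsWithin_iff.2 ⟨?_, ?_⟩
      · have : Continuous fun t : ℝ => t / s₀ := by fun_prop
        simpa using (this.tendsto 0).mono_left nhdsWithin_le_nhds
      · filter_upwards [self_mem_nhdsWithin] with t ht using div_pos ht hs₀0
    filter_upwards [ht.eventually hγf, mem_nhdsWithin_of_mem_nhds (gt_mem_nhds hs₁)] with t h1 h2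
    rw [if_pos h2, h1, ray_ray, mul_div_cancel₀ _ hs₀0.ne']
  · exact if_neg (not_lt.2 (h₁₀.le.trans hs₀))

theorem continues_of_forall_mem {Ω : Set (ℂ × (Fin N → ℂ))} (hΩ : IsOpen Ω)
    {f : ℂ × (Fin N → ℂ) → ℂ} (hf : DifferentiableOn ℂ f Ω) {p : ℂ × (Fin N → ℂ)}
    (hp : ∀ s ∈ Ioc (0 : ℝ) 1, (p.1, ray p.2 s) ∈ Ω) : Continues f p (f p) := by
  refine ⟨fun s => f (p.1, ray p.2 s), fun s hs => ?_, Eventually.of_forall fun s => rfl, ?_⟩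
  · have hc : Continuous fun z : Fin N → ℂ => (p.1, z) := by fun_prop
    exact analyticAt_comp_ray (g := fun z => f (p.1, z)) (hΩ.preimage hc)
      (hf.comp (Differentiable.differentiableOn (by fun_prop)) (mapsTo_preimage _ _)) (hp s hs)
  · simp [ray_one]

/-- The value of the continuation of `f` along rays (junk where there is none). -/
noncomputable def rayValue (f : ℂ × (Fin N → ℂ) → ℂ) (p : ℂ × (Fin N → ℂ)) : ℂ :=
  Classical.epsilon (Continues f p)

/-- The points near which the continuation along rays exists and is holomorphic. -/
def rayRegular (f : ℂ × (Fin N → ℂ) → ℂ) : Set (ℂ × (Fin N → ℂ)) :=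
  {p | ∃ G : ℂ × (Fin N → ℂ) → ℂ,
    ∀ᶠ q in 𝓝 p, DifferentiableAt ℂ G q ∧ Continues f q (G q)}

theorem Continues.rayValue_eq {f : ℂ × (Fin N → ℂ) → ℂ} {p : ℂ × (Fin N → ℂ)} {c : ℂ}
    (h : Continues f p c) : rayValue f p = c :=
  Continues.unique (Classical.epsilon_spec (p := Continues f p) ⟨c, h⟩) h

theorem isOpen_rayRegular (f : ℂ × (Fin N → ℂ) → ℂ) : IsOpen (rayRegular f) := by
  rw [isOpen_iff_mem_nhds]
  rintro p ⟨G, hG⟩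
  filter_upwards [hG.eventually_nhds] with q hq using ⟨G, hq⟩

theorem continues_rayValue {f : ℂ × (Fin N → ℂ) → ℂ} {p : ℂ × (Fin N → ℂ)}
    (hp : p ∈ rayRegular f) : Continues f p (rayValue f p) := by
  obtain ⟨G, hG⟩ := hp
  exact Classical.epsilon_spec (p := Continues f p) ⟨_, hG.self_of_nhds.2⟩

theorem differentiableOn_rayValue (f : ℂ × (Fin N → ℂ) → ℂ) :
    DifferentiableOn ℂ (rayValue f) (rayRegular f) := by
  rintro p ⟨G, hG⟩
  refine DifferentiableAt.differentiableWithinAt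
    (hG.self_of_nhds.1.congr_of_eventuallyEq ?_)
  filter_upwards [hG] with q hq using hq.2.rayValue_eq

theorem mem_rayRegular_of_eventually {Ω : Set (ℂ × (Fin N → ℂ))} (hΩ : IsOpen Ω)
    {f : ℂ × (Fin N → ℂ) → ℂ} (hf : DifferentiableOn ℂ f Ω) {p : ℂ × (Fin N → ℂ)}
    (hp : ∀ᶠ q in 𝓝 p, ∀ s ∈ Ioc (0 : ℝ) 1, (q.1, ray q.2 s) ∈ Ω) : p ∈ rayRegular f := by
  refine ⟨f, ?_⟩
  filter_upwards [hp] with q hq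
  refine ⟨hf.differentiableAt (hΩ.mem_nhds ?_), continues_of_forall_mem hΩ hf hq⟩
  simpa [ray_one] using hq 1 (right_mem_Ioc.2 one_pos)

/-! ### Sweeping out the wedge by analytic discs -/

/-- The family of analytic discs `w ↦ x + i (τ - ψ w) y`. The height of the disc above the real
points is `(τ - Re ψ) y`, so only the part of the disc over `Re ψ < τ` matters. -/
noncomputable def disc (ψ : ℂ → ℂ) (x y : Fin N → ℝ) (τ : ℝ) (w : ℂ) : Fin N → ℂ :=
  fun j => x j + Complex.I * (τ - ψ w) * y j

theorem disc_re (ψ : ℂ → ℂ) (x y : Fin N → ℝ) (τ : ℝ) (w : ℂ) (j : Fin N) :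
    (disc ψ x y τ w j).re = x j + (ψ w).im * y j := by
  simp [disc]

theorem disc_im (ψ : ℂ → ℂ) (x y : Fin N → ℝ) (τ : ℝ) (w : ℂ) (j : Fin N) :
    (disc ψ x y τ w j).im = (τ - (ψ w).re) * y j := by
  simp [disc]

theorem differentiableOn_disc {ψ : ℂ → ℂ} (hψ : DifferentiableOn ℂ ψ upperHalf) (x y : Fin N → ℝ)
    (τ : ℝ) : DifferentiableOn ℂ (disc ψ x y τ) upperHalf := by
  refine differentiableOn_pi.2 fun j => ?_
  unfold disc
  exact (((hψ.const_sub _).const_mul _).mul_const _).const_add _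

theorem ray_disc (ψ : ℂ → ℂ) (x y : Fin N → ℝ) (τ τ' : ℝ) (w : ℂ) (h : (ψ w).re < τ) :
    ray (disc ψ x y τ w) (((τ' - (ψ w).re) / (τ - (ψ w).re) : ℝ) : ℂ) = disc ψ x y τ' w := by
  have : τ - (ψ w).re ≠ 0 := by linarith
  funext j
  apply Complex.ext
  · rw [ray_re, disc_re, disc_re]
  · rw [ray_im, disc_im, disc_im]
    field_simp

theorem norm_disc_sub_disc_le {ψ : ℂ → ℂ} {x y : Fin N → ℝ} (hy : ∀ j, 0 < y j ∧ y j ≤ 1)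
    (τ τ' : ℝ) (w : ℂ) : ‖disc ψ x y τ w - disc ψ x y τ' w‖ ≤ |τ - τ'| := by
  refine (pi_norm_le_iff_of_nonneg (abs_nonneg _)).2 fun j => ?_
  have : (disc ψ x y τ w - disc ψ x y τ' w) j = Complex.I * ((τ - τ' : ℝ) : ℂ) * (y j : ℝ) := by
    simp only [disc, Pi.sub_apply]
    push_cast
    ring
  rw [this, norm_mul, norm_mul, Complex.norm_I, one_mul, Complex.norm_real, Complex.norm_real,
    Real.norm_eq_abs, Real.norm_eq_abs, abs_of_pos (hy j).1]
  exact mul_le_of_le_one_right (abs_nonneg _) (hy j).2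

end Rays

section Sweep

variable {N : ℕ}

/-- All points of the discs `disc ψ x y τ` with `τ < 2` are ray-regular for `f`, provided the
neighbourhoods of radius `r` of these discs, inside `Im z > 0`, are ray-wise contained in the domain
`Ω` of `f` at all points `w` where the disc is low (`τ < Re ψ w + 2 θ`) or where `w` is close to the
real axis (`Im w < κ`).

The proof raises `τ` by steps of `r / 2`. Around the disc with parameter `t₀`, over the set
`U = {Re ψ < t₀ - θ}`, the function is known near the disc, and in the whole tube of radius `r` over
the complement in `U` of a compact set, where it is `f` itself; the Hartogs-type lemma then gives
the tube of radius `r` over all of `U`. -/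
theorem disc_mem_rayRegular {Ω : Set (ℂ × (Fin N → ℂ))} (hΩ : IsOpen Ω)
    {f : ℂ × (Fin N → ℂ) → ℂ} (hf : DifferentiableOn ℂ f Ω) {ψ : ℂ → ℂ}
    (hψ : DifferentiableOn ℂ ψ upperHalf) (hψ0 : ∀ w ∈ upperHalf, 0 ≤ (ψ w).re)
    (hψb : ∀ M : ℝ, ∃ b : ℝ, ∀ w ∈ upperHalf, (ψ w).re ≤ M → ‖w‖ ≤ b)
    {x y : Fin N → ℝ} (hy : ∀ j, 0 < y j ∧ y j ≤ 1) {θ r κ : ℝ} (hr : 0 < r) (hrθ : r ≤ θ)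
    (hry : ∀ j, r ≤ θ * y j) (hκ : 0 < κ)
    (hbase : ∀ w ∈ upperHalf, ∀ τ : ℝ, (ψ w).re < τ → τ < 2 →
      (τ < (ψ w).re + 2 * θ ∨ w.im < κ) → ∀ v : Fin N → ℂ, ‖v‖ < r →
      (∀ j, 0 < ((disc ψ x y τ w + v) j).im) →
      ∀ s ∈ Ioc (0 : ℝ) 1, (w, ray (disc ψ x y τ w + v) s) ∈ Ω)
    {w : ℂ} (hw : w ∈ upperHalf) {τ : ℝ} (hwτ : (ψ w).re < τ) (hτ : τ < 2) :
    (w, disc ψ x y τ w) ∈ rayRegular f := by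
  have hre : ContinuousOn (fun w => (ψ w).re) upperHalf :=
    Complex.continuous_re.comp_continuousOn hψ.continuousOn
  have hdc : ∀ (τ : ℝ), ∀ w ∈ upperHalf, ContinuousAt (disc ψ x y τ) w := fun τ w hw =>
    ((differentiableOn_disc hψ x y τ).differentiableAt (isOpen_upperHalf.mem_nhds hw)).continuousAt
  -- continuity of `(w, z) ↦ z - disc τ w`
  have hsubc : ∀ (τ : ℝ) (w : ℂ) (z : Fin N → ℂ), w ∈ upperHalf →
      ContinuousAt (fun q : ℂ × (Fin N → ℂ) => q.2 - disc ψ x y τ q.1) (w, z) := by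
    intro τ w z hw
    exact continuous_snd.continuousAt.sub
      (ContinuousAt.comp (f := Prod.fst) (x := (w, z)) (hdc τ w hw) continuous_fst.continuousAt)
  suffices hS : ∀ n : ℕ, ∀ w ∈ upperHalf, ∀ τ : ℝ, (ψ w).re < τ → τ < 2 → τ < n * (r / 2) →
      (w, disc ψ x y τ w) ∈ rayRegular f by
    obtain ⟨n, hn⟩ := exists_nat_gt (τ / (r / 2))
    exact hS n w hw τ hwτ hτ ((div_lt_iff₀ (by positivity)).1 hn)
  intro n
  induction n with
  | zero =>
    intro w hw τ h1 _ h3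
    have := hψ0 w hw
    simp only [Nat.cast_zero, zero_mul] at h3
    linarith
  | succ n ih =>
  intro w₁ hw₁ τ₁ hwτ₁ hτ₁ hτn
  set t : ℝ := n * (r / 2)
  have hτt : τ₁ < t + r / 2 := by
    push_cast at hτn
    simp only [t]
    linarith
  rcases lt_or_ge τ₁ t with hlt | hge
  · exact ih w₁ hw₁ τ₁ hwτ₁ hτ₁ hlt
  set t₀ : ℝ := t - r / 2
  rcases le_or_gt (t₀ - θ) (ψ w₁).re with hlow | hhigh
  · -- here the disc is low, and `f` itself is defined near its point over `w₁`
    refine mem_rayRegular_of_eventually hΩ hf ?_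
    have e1 : ∀ᶠ q : ℂ × (Fin N → ℂ) in 𝓝 (w₁, disc ψ x y τ₁ w₁), q.1 ∈ upperHalf :=
      continuous_fst.continuousAt.eventually (isOpen_upperHalf.mem_nhds hw₁)
    have hrec : ContinuousAt (fun q : ℂ × (Fin N → ℂ) => (ψ q.1).re)
        (w₁, disc ψ x y τ₁ w₁) :=
      ContinuousAt.comp (f := Prod.fst) (x := (w₁, disc ψ x y τ₁ w₁))
        (hre.continuousAt (isOpen_upperHalf.mem_nhds hw₁)) continuous_fst.continuousAt
    have e2 := hrec.eventually (gt_mem_nhds hwτ₁)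
    have e3 := hrec.eventually (lt_mem_nhds (show τ₁ - 2 * θ < (ψ w₁).re by
      simp only [t₀] at hlow
      linarith))
    have e4 : ∀ᶠ q : ℂ × (Fin N → ℂ) in 𝓝 (w₁, disc ψ x y τ₁ w₁),
        q.2 - disc ψ x y τ₁ q.1 ∈ ball 0 r :=
      (hsubc τ₁ w₁ _ hw₁).eventually (isOpen_ball.mem_nhds (by simpa using hr))
    have e5 : ∀ᶠ q : ℂ × (Fin N → ℂ) in 𝓝 (w₁, disc ψ x y τ₁ w₁), ∀ j, 0 < (q.2 j).im := by
      refine eventually_all.2 fun j => ?_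
      have hc : Continuous fun q : ℂ × (Fin N → ℂ) => (q.2 j).im :=
        Complex.continuous_im.comp (by fun_prop)
      refine hc.continuousAt.eventually (lt_mem_nhds ?_)
      change 0 < (disc ψ x y τ₁ w₁ j).im
      rw [disc_im]
      exact mul_pos (by linarith) (hy j).1
    filter_upwards [e1, e2, e3, e4, e5] with q h1 h2 h3 h4 h5
    have := hbase q.1 h1 τ₁ h2 hτ₁ (Or.inl (by linarith)) (q.2 - disc ψ x y τ₁ q.1)
      (mem_ball_zero_iff.1 h4)
    rw [add_sub_cancel] at this
    exact this h5
  -- the tube around the disc with parameter `t₀`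
  have ht₀2 : t₀ < 2 := by
    simp only [t₀]
    linarith
  have ht₀τ : t₀ < τ₁ := by
    simp only [t₀]
    linarith
  set U : Set ℂ := upperHalf ∩ {w | (ψ w).re < t₀ - θ}
  have hU : IsOpen U := hre.isOpen_inter_preimage isOpen_upperHalf isOpen_Iio
  set Ψ : ℂ × (Fin N → ℂ) → ℂ × (Fin N → ℂ) := fun p => (p.1, disc ψ x y t₀ p.1 + p.2)
  have hΨ : DifferentiableOn ℂ Ψ (U ×ˢ univ) := by
    refine differentiableOn_fst.prodMk (DifferentiableOn.add ?_ differentiableOn_snd)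
    exact (differentiableOn_disc hψ x y t₀).comp differentiableOn_fst fun p hp => hp.1.1
  set X : Set (ℂ × (Fin N → ℂ)) := (U ×ˢ univ) ∩ Ψ ⁻¹' rayRegular f
  have hX : IsOpen X := hΨ.continuousOn.isOpen_inter_preimage (hU.prod isOpen_univ)
    (isOpen_rayRegular f)
  have hUX : ∀ w ∈ U, (w, (0 : Fin N → ℂ)) ∈ X := by
    intro w hw
    refine ⟨⟨hw, mem_univ _⟩, ?_⟩
    have : (ψ w).re < t₀ - θ := hw.2
    have := ih w hw.1 t₀ (by linarith) ht₀2 (by simp only [t₀]; linarith)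
    simpa [Ψ] using this
  have hFX : DifferentiableOn ℂ (fun p => rayValue f (Ψ p)) X :=
    (differentiableOn_rayValue f).comp (hΨ.mono inter_subset_left) fun p hp => hp.2
  obtain ⟨b, hb⟩ := hψb (t₀ - 2 * θ)
  set C₀ : Set ℂ := closedBall 0 b ∩ {w | κ ≤ w.im}
  have hC₀ : IsCompact C₀ := (isCompact_closedBall _ _).inter_right
    (isClosed_le continuous_const Complex.continuous_im)
  have hC₀U : C₀ ⊆ upperHalf := fun w hw => lt_of_lt_of_le hκ hw.2
  set C : Set ℂ := C₀ ∩ {w | (ψ w).re ≤ t₀ - 2 * θ}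
  have hC : IsCompact C := hC₀.of_isClosed_subset
    ((hre.mono hC₀U).preimage_isClosed_of_isClosed hC₀.isClosed isClosed_Iic) inter_subset_left
  have hCU : C ⊆ U := fun w hw => ⟨hC₀U hw.1, by
    have : (ψ w).re ≤ t₀ - 2 * θ := hw.2
    simp only [mem_ofPred_eq]
    linarith⟩
  have hpos : ∀ w ∈ U, ∀ v ∈ ball (0 : Fin N → ℂ) r, ∀ j,
      0 < ((disc ψ x y t₀ w + v) j).im := by
    intro w hw v hv j
    rw [Pi.add_apply, Complex.add_im, disc_im]
    have h1 : (ψ w).re < t₀ - θ := hw.2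
    have h2 : |(v j).im| < r :=
      ((Complex.abs_im_le_norm _).trans (norm_le_pi_norm v j)).trans_lt (mem_ball_zero_iff.1 hv)
    have h3 := (abs_lt.1 h2).1
    have h4 : θ * y j < (t₀ - (ψ w).re) * y j := by
      have := (hy j).1
      gcongr
      linarith
    linarith [hry j]
  have hT := differentiableOn_taylorSum hU hC hCU hX hFX hUX (r := r) ?_
  swap
  · rintro w ⟨hw, hwC⟩
    set A : Set ℂ := U ∩ {w | t₀ < (ψ w).re + 2 * θ ∨ w.im < κ}
    have hA : A ∈ 𝓝 w := by
      refine inter_mem (hU.mem_nhds hw) ?_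
      by_cases h : t₀ < (ψ w).re + 2 * θ
      · have := (hre.continuousAt (isOpen_upperHalf.mem_nhds hw.1)).eventually
          (lt_mem_nhds (show t₀ - 2 * θ < (ψ w).re by linarith))
        filter_upwards [this] with w' hw'
        exact Or.inl (by linarith)
      · have hκw : w.im < κ := by
          by_contra hκw
          exact hwC ⟨⟨mem_closedBall_zero_iff.2 (hb w hw.1 (by linarith)), not_lt.1 hκw⟩,
            show (ψ w).re ≤ t₀ - 2 * θ by linarith⟩
        filter_upwards [Complex.continuous_im.continuousAt.eventually (gt_mem_nhds hκw)] with w' hw'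
        exact Or.inr hw'
    have hAb : ∀ w' ∈ A, ∀ v ∈ ball (0 : Fin N → ℂ) r, ∀ s ∈ Ioc (0 : ℝ) 1,
        (w', ray (disc ψ x y t₀ w' + v) s) ∈ Ω := by
      intro w' hw' v hv
      have h1 : (ψ w').re < t₀ - θ := hw'.1.2
      exact hbase w' hw'.1.1 t₀ (by linarith) ht₀2 hw'.2 v (mem_ball_zero_iff.1 hv)
        (hpos w' hw'.1 v hv)
    refine ⟨A, hA, fun p => f (Ψ p), ?_, ?_⟩
    · refine hf.comp (hΨ.mono (prod_mono inter_subset_left (subset_univ _))) ?_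
      rintro ⟨w', v⟩ ⟨hw', hv⟩
      simpa [ray_one] using hAb w' hw' v hv 1 (right_mem_Ioc.2 one_pos)
    · filter_upwards [prod_mem_nhds hA (ball_mem_nhds (0 : Fin N → ℂ) hr)] with p hp
      exact (continues_of_forall_mem hΩ hf (p := Ψ p)
        (hAb p.1 hp.1 p.2 hp.2)).rayValue_eq.symm
  set T : ℂ × (Fin N → ℂ) → ℂ := fun p => taylorSum (fun u => rayValue f (Ψ (p.1, u))) p.2
  have hw₁U : w₁ ∈ U := ⟨hw₁, hhigh⟩
  -- near the disc the new function is the known one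
  obtain ⟨e, he, heX⟩ : ∃ e > 0, ball w₁ e ×ˢ ball (0 : Fin N → ℂ) e ⊆ X := by
    obtain ⟨e, he, h⟩ := Metric.isOpen_iff.1 hX _ (hUX w₁ hw₁U)
    exact ⟨e, he, by rwa [ball_prod_same]⟩
  have hTe : ∀ w ∈ ball w₁ e, ∀ v ∈ ball (0 : Fin N → ℂ) e,
      Continues f (w, disc ψ x y t₀ w + v) (T (w, v)) := by
    intro w hw v hv
    have hEq : T (w, v) = rayValue f (Ψ (w, v)) := by
      refine taylorSum_eq (φ := fun u => rayValue f (Ψ (w, u))) (r := e) EventuallyEq.rfl ?_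
        (mem_ball_zero_iff.1 hv)
      exact hFX.comp (f := fun u : Fin N → ℂ => (w, u))
        (Differentiable.differentiableOn (by fun_prop)) fun u hu => heX ⟨hw, hu⟩
    rw [hEq]
    exact continues_rayValue (heX ⟨hw, hv⟩ : (w, v) ∈ X).2
  -- the point of the disc `τ₁` over `w₁` is joined along its ray to the disc `t₀`
  set s₁ : ℝ := (t₀ - (ψ w₁).re) / (τ₁ - (ψ w₁).re)
  have hθ : 0 < θ := hr.trans_le hrθ
  have hden : 0 < τ₁ - (ψ w₁).re := by linarith
  have hs₁ : 0 < s₁ := div_pos (by linarith) hden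
  have hs₁1 : s₁ < 1 := (div_lt_one hden).2 (by linarith)
  set z₁ := disc ψ x y τ₁ w₁
  have hray : ∀ s : ℝ, ray z₁ s = disc ψ x y ((ψ w₁).re + s * (τ₁ - (ψ w₁).re)) w₁ := by
    intro s
    rw [← ray_disc ψ x y τ₁ _ w₁ hwτ₁, add_sub_cancel_left, mul_div_cancel_right₀ _ hden.ne']
  have hs₁t : (ψ w₁).re + s₁ * (τ₁ - (ψ w₁).re) = t₀ := by
    simp only [s₁]
    rw [div_mul_cancel₀ _ hden.ne']
    ring
  have hray₁ : ray z₁ s₁ = disc ψ x y t₀ w₁ := by rw [hray, hs₁t]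
  -- continuity of `(w, z, s) ↦ ray z s - disc t₀ w`
  have hrc : ∀ s : ℝ, ContinuousAt (fun q : (ℂ × (Fin N → ℂ)) × ℝ =>
      ray q.1.2 (q.2 : ℂ) - disc ψ x y t₀ q.1.1) ((w₁, z₁), s) := by
    intro s
    have h1 : Continuous fun q : (ℂ × (Fin N → ℂ)) × ℝ => ray q.1.2 (q.2 : ℂ) :=
      continuous_ray.comp (f := fun q : (ℂ × (Fin N → ℂ)) × ℝ => (q.1.2, (q.2 : ℂ))) (by fun_prop)
    exact h1.continuousAt.sub (ContinuousAt.comp (f := fun q : (ℂ × (Fin N → ℂ)) × ℝ => q.1.1)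
      (x := ((w₁, z₁), s)) (hdc t₀ w₁ hw₁) (Continuous.continuousAt (by fun_prop)))
  have hloc : ∀ᶠ q in 𝓝 ((w₁, z₁), s₁),
      ray q.1.2 (q.2 : ℂ) - disc ψ x y t₀ q.1.1 ∈ ball (0 : Fin N → ℂ) e := by
    refine (hrc s₁).eventually (isOpen_ball.mem_nhds ?_)
    simpa [hray₁] using he
  obtain ⟨V, hV, η, hη, hVη⟩ : ∃ V ∈ 𝓝 (w₁, z₁), ∃ η > 0, ∀ q ∈ V, ∀ s ∈ ball s₁ η,
      ray q.2 (s : ℂ) - disc ψ x y t₀ q.1 ∈ ball (0 : Fin N → ℂ) e := by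
    rw [nhds_prod_eq] at hloc
    obtain ⟨p₁, hp₁, p₂, hp₂, h⟩ := eventually_prod_iff.1 hloc
    obtain ⟨η, hη, hη'⟩ := Metric.eventually_nhds_iff_ball.1 hp₂
    exact ⟨{q | p₁ q}, hp₁, η, hη, fun q hq s hs => h hq (hη' s hs)⟩
  obtain ⟨s₀, h₁₀, hs₀⟩ := exists_between (lt_min hs₁1 (lt_add_of_pos_right s₁ hη))
  have hs₀1 : s₀ < 1 := hs₀.trans_le (min_le_left _ _)
  have hs₀η : s₀ ∈ ball s₁ η := by
    rw [mem_ball, Real.dist_eq, abs_of_pos (by linarith)]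
    linarith [hs₀.trans_le (min_le_right _ _)]
  have htube : ∀ᶠ q in 𝓝 (w₁, z₁), ∀ s ∈ Icc s₁ 1,
      ray q.2 ((s : ℝ) : ℂ) - disc ψ x y t₀ q.1 ∈ ball (0 : Fin N → ℂ) r := by
    refine isCompact_Icc.eventually_forall_of_forall_eventually fun s hs => ?_
    refine (hrc s).eventually (isOpen_ball.mem_nhds ?_)
    simp only [hray]
    rw [mem_ball_zero_iff]
    refine (norm_disc_sub_disc_le hy _ _ _).trans_lt ?_
    rw [abs_lt]
    have h1 : s₁ * (τ₁ - (ψ w₁).re) ≤ s * (τ₁ - (ψ w₁).re) :=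
      mul_le_mul_of_nonneg_right hs.1 hden.le
    have h2 : s * (τ₁ - (ψ w₁).re) ≤ 1 * (τ₁ - (ψ w₁).re) :=
      mul_le_mul_of_nonneg_right hs.2 hden.le
    constructor
    · linarith
    · simp only [t₀] at *
      linarith
  refine ⟨fun q => T (q.1, q.2 - disc ψ x y t₀ q.1), ?_⟩
  filter_upwards [hV, htube, continuous_fst.continuousAt.eventually (hU.mem_nhds hw₁U),
    continuous_fst.continuousAt.eventually (ball_mem_nhds w₁ he)] with q hqV hqt hqU hqe
  have hq1 : q.2 - disc ψ x y t₀ q.1 ∈ ball (0 : Fin N → ℂ) r := by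
    simpa [ray_one] using hqt 1 (right_mem_Icc.2 hs₁1.le)
  constructor
  · refine DifferentiableAt.comp (f := fun q : ℂ × (Fin N → ℂ) =>
      (q.1, q.2 - disc ψ x y t₀ q.1)) q
      (hT.differentiableAt ((hU.prod isOpen_ball).mem_nhds ⟨hqU, hq1⟩)) ?_
    refine differentiableAt_fst.prodMk (differentiableAt_snd.sub ?_)
    exact DifferentiableAt.comp (f := Prod.fst) q
      ((differentiableOn_disc hψ x y t₀).differentiableAt (isOpen_upperHalf.mem_nhds hqU.1))
      differentiableAt_fst
  · have hcont : ∀ s ∈ ball s₁ η, Continues f (q.1, ray q.2 ((s : ℝ) : ℂ))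
        (T (q.1, ray q.2 (s : ℂ) - disc ψ x y t₀ q.1)) := by
      intro s hs
      have := hTe q.1 hqe _ (hVη q hqV s hs)
      rwa [add_sub_cancel] at this
    have := Continues.concat (f := f) (w := q.1) (z := q.2) hs₁ h₁₀ hs₀1.le (hcont s₀ hs₀η)
      (g := fun s => T (q.1, ray q.2 ((s : ℝ) : ℂ) - disc ψ x y t₀ q.1)) ?_ ?_
    · simpa [ray_one] using this
    · intro s hs
      refine analyticAt_comp_ray (g := fun z => T (q.1, z - disc ψ x y t₀ q.1))
        (S := ball (disc ψ x y t₀ q.1) r) isOpen_ball ?_ (mem_ball_iff_norm.2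
          (mem_ball_zero_iff.1 (hqt s hs)))
      refine hT.comp (f := fun z : Fin N → ℂ => (q.1, z - disc ψ x y t₀ q.1))
        (Differentiable.differentiableOn (by fun_prop)) fun z hz => ⟨hqU, ?_⟩
      exact mem_ball_zero_iff.2 (mem_ball_iff_norm.1 hz)
    · filter_upwards [ball_mem_nhds s₁ hη] with s hs using hcont s hs

end Sweep

/-! ### Extension over a small wedge -/

section Wedge

variable {N : ℕ}

/-- A small box inside the upper half-polydisk, touching its real points. -/
def wedgeBox (N : ℕ) : Set (Fin N → ℂ) :=
  {z | ∀ j, |(z j).re| < 1 / 10 ∧ 0 < (z j).im ∧ (z j).im < 1 / 10}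

theorem mem_halfPolydisk_of_lt {z : Fin N → ℂ} (h : ∀ j, 0 < (z j).im)
    (h' : ∀ j, |(z j).re| + (z j).im < 1) : z ∈ halfPolydisk N := by
  refine fun j => ⟨?_, h j⟩
  have := Complex.norm_le_abs_re_add_abs_im (z j)
  rw [abs_of_pos (h j)] at this
  exact this.trans_lt (h' j)

theorem wedgeBox_subset : wedgeBox N ⊆ halfPolydisk N := fun z hz =>
  mem_halfPolydisk_of_lt (fun j => (hz j).2.1) fun j => by linarith [(hz j).1, (hz j).2.2]

theorem isOpen_wedgeBox : IsOpen (wedgeBox N) := by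
  simp only [wedgeBox, ofPred_forall]
  refine isOpen_iInter_of_finite fun j => ?_
  have h1 : Continuous fun z : Fin N → ℂ => (z j).re := Complex.continuous_re.comp (by fun_prop)
  have h2 : Continuous fun z : Fin N → ℂ => (z j).im := Complex.continuous_im.comp (by fun_prop)
  exact (isOpen_lt h1.abs continuous_const).inter
    ((isOpen_lt continuous_const h2).inter (isOpen_lt h2 continuous_const))

theorem wedgeBox_nonempty : (wedgeBox N).Nonempty := by
  refine ⟨fun _ => ⟨0, 1 / 20⟩, fun j => ?_⟩
  norm_num

theorem closure_upperHalf : closure upperHalf = {w | 0 ≤ w.im} := Complex.closure_setOfPred_lt_im 0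

variable {D : Set (Fin N → ℂ)} {𝒩 : Set (ℂ × (Fin N → ℂ))}

/-- Over compact annuli in `ℂ₊`, the domain contains all points of the half-polydisk that are
uniformly close to real points of norm at most `1 / 2`. -/
theorem exists_uniform_near_realPolydisk (hPD : halfPolydisk N ⊆ D) (h𝒩 : IsOpen 𝒩)
    (hsub : (realPunctured ×ˢ D) ∪ ((closure upperHalf \ {0}) ×ˢ realPolydisk N) ⊆ 𝒩)
    {a b : ℝ} (ha : 0 < a) :
    ∃ ε > 0, ∀ w ∈ upperHalf, a ≤ ‖w‖ → ‖w‖ ≤ b → ∀ z : Fin N → ℂ,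
      (∀ j, 0 < (z j).im) → (∀ j, |(z j).re| + (z j).im < 1) → (∀ j, |(z j).re| ≤ 1 / 2) →
      (∀ j, (z j).im < ε) → (w, z) ∈ 𝒩 ∩ (upperHalf ×ˢ D) := by
  set K : Set ℂ := closedBall 0 b ∩ {w | 0 ≤ w.im ∧ a ≤ ‖w‖}
  have hK : IsCompact K := (isCompact_closedBall _ _).inter_right
    ((isClosed_le continuous_const Complex.continuous_im).inter
      (isClosed_le continuous_const continuous_norm))
  set Z : Set (Fin N → ℂ) := closedBall 0 (1 / 2) ∩ {z | ∀ j, (z j).im = 0}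
  have hZ : IsCompact Z := by
    refine (isCompact_closedBall _ _).inter_right ?_
    simp only [ofPred_forall]
    refine isClosed_iInter fun j => isClosed_eq ?_ continuous_const
    exact Complex.continuous_im.comp (by fun_prop)
  have hKZ : K ×ˢ Z ⊆ 𝒩 := by
    rintro ⟨w, z⟩ ⟨⟨-, hw, hwa⟩, hz, hz'⟩
    refine hsub (Or.inr ⟨⟨by rw [closure_upperHalf]; exact hw, ?_⟩, fun j => ⟨?_, hz' j⟩⟩)
    · rintro rfl
      simp only [norm_zero] at hwa
      linarith
    · refine ((norm_le_pi_norm z j).trans (mem_closedBall_zero_iff.1 hz)).trans_lt (by norm_num)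
  obtain ⟨ε, hε, hεN⟩ := (hK.prod hZ).exists_thickening_subset_open h𝒩 hKZ
  refine ⟨ε, hε, fun w hw hwa hwb z hz hz1 hzr hzε => ⟨hεN ?_, hw, hPD ?_⟩⟩
  · rw [mem_thickening_iff]
    refine ⟨(w, fun j => ((z j).re : ℂ)), ⟨⟨mem_closedBall_zero_iff.2 hwb, le_of_lt hw, hwa⟩,
      ?_, fun j => by simp⟩, ?_⟩
    · rw [mem_closedBall_zero_iff, pi_norm_le_iff_of_nonneg (by norm_num)]
      intro j
      rw [Complex.norm_real]
      exact hzr j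
    · rw [Prod.dist_eq, dist_self, max_lt_iff]
      refine ⟨hε, (dist_pi_lt_iff hε).2 fun j => ?_⟩
      have h1 : z j - ((z j).re : ℂ) = (z j).im * Complex.I := by apply Complex.ext <;> simp
      rw [dist_eq_norm]
      change ‖z j - ((z j).re : ℂ)‖ < ε
      rw [h1, norm_mul, Complex.norm_I, mul_one, Complex.norm_real, Real.norm_eq_abs,
        abs_of_pos (hz j)]
      exact hzε j
  · exact mem_halfPolydisk_of_lt hz hz1

/-- Over compact annuli in `ℂ₊`, the domain contains the points of the half-polydisk for which `w` is
uniformly close to the real axis and `z` to a compact piece of `{x + i σ y | σ ≥ 0}`, with `y` fixed.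
The direction `y` is kept away from the coordinate hyperplanes because the frontier of the
half-polydisk may meet the complement of `D` at points with only some real coordinates. -/
theorem exists_uniform_near_wedge (hPD : halfPolydisk N ⊆ D) (h𝒩 : IsOpen 𝒩)
    (hsub : (realPunctured ×ˢ D) ∪ ((closure upperHalf \ {0}) ×ˢ realPolydisk N) ⊆ 𝒩)
    {y : Fin N → ℝ} (hy : ∀ j, 0 < y j ∧ y j < 1 / 10) {a b : ℝ} (ha : 0 < a) :
    ∃ κ > 0, ∀ w ∈ upperHalf, a ≤ ‖w‖ → ‖w‖ ≤ b → w.im < κ → ∀ z : Fin N → ℂ,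
      (∀ j, 0 < (z j).im) → (∀ j, |(z j).re| + (z j).im < 1) →
      ∀ x : Fin N → ℝ, (∀ j, |x j| ≤ 1 / 2) → ∀ σ ∈ Icc (0 : ℝ) 2,
      (∀ j, ‖z j - (x j + σ * y j * Complex.I)‖ < κ) →
      (w, z) ∈ 𝒩 ∩ (upperHalf ×ˢ D) := by
  set Z : Set (Fin N → ℂ) := (fun p : (Fin N → ℝ) × ℝ => fun j =>
    ((p.1 j : ℂ) + p.2 * y j * Complex.I)) '' (closedBall 0 (1 / 2) ×ˢ Icc 0 2)
  have hZ : IsCompact Z :=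
    ((isCompact_closedBall _ _).prod isCompact_Icc).image (by fun_prop)
  have hP : ∀ x ∈ realPunctured, ∀ z ∈ Z, ∀ᶠ p in 𝓝 (x, z), p ∈ 𝒩 := by
    rintro x hx z ⟨⟨x', σ⟩, ⟨hx', hσ⟩, rfl⟩
    refine h𝒩.mem_nhds (hsub ?_)
    have hx'' : ∀ j, |x' j| ≤ 1 / 2 := fun j =>
      (norm_le_pi_norm x' j).trans (mem_closedBall_zero_iff.1 hx')
    rcases hσ.1.eq_or_lt with h0 | h0
    · right
      refine ⟨⟨by rw [closure_upperHalf]; exact hx.1.ge, hx.2⟩, fun j => ?_⟩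
      have h0' : σ = 0 := h0.symm
      simp only [h0', Complex.ofReal_zero, zero_mul, add_zero, Complex.ofReal_im, and_true]
      rw [Complex.norm_real]
      exact (hx'' j).trans_lt (by norm_num)
    · left
      refine ⟨hx, hPD (mem_halfPolydisk_of_lt (fun j => ?_) fun j => ?_)⟩
      · simpa using mul_pos h0 (hy j).1
      · simp only [Complex.add_re, Complex.ofReal_re, Complex.mul_re, Complex.mul_im,
          Complex.ofReal_im, Complex.I_re, Complex.I_im, Complex.add_im]
        have h1 : σ * y j ≤ 2 * (1 / 10) :=
          mul_le_mul hσ.2 (hy j).2.le (hy j).1.le (by norm_num)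
        have h2 := hx'' j
        ring_nf at h1 h2 ⊢
        linarith
  obtain ⟨κ, hκ, h⟩ := exists_uniform_near_real hZ (b := b) ha hP
  refine ⟨κ, hκ, fun w hw hwa hwb hwκ z hz hz1 x hx σ hσ hzx => ⟨?_, hw, ?_⟩⟩
  · refine h w hwa hwb (by rwa [abs_of_pos hw]) z _ ⟨(x, σ), ⟨?_, hσ⟩, rfl⟩ ?_
    · rw [mem_closedBall_zero_iff, pi_norm_le_iff_of_nonneg (by norm_num)]
      exact hx
    · refine (dist_pi_lt_iff hκ).2 fun j => ?_
      rw [dist_eq_norm]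
      exact hzx j
  · exact hPD (mem_halfPolydisk_of_lt hz hz1)

/-- Every point over the box lies on one of the discs: given the target `(w₁, z₁)`, the direction is
`Im z₁`, and the barrier is scaled so as to be small at `w₁`. -/
theorem prod_wedgeBox_subset_rayRegular (hPD : halfPolydisk N ⊆ D) (hD : IsOpen D)
    (h𝒩 : IsOpen 𝒩)
    (hsub : (realPunctured ×ˢ D) ∪ ((closure upperHalf \ {0}) ×ˢ realPolydisk N) ⊆ 𝒩)
    {f : ℂ × (Fin N → ℂ) → ℂ} (hf : DifferentiableOn ℂ f (𝒩 ∩ (upperHalf ×ˢ D))) :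
    upperHalf ×ˢ wedgeBox N ⊆ rayRegular f := by
  rintro ⟨w₁, z₁⟩ ⟨hw₁, hz₁⟩
  obtain ⟨φ, hφd, hφi, hφ⟩ := exists_barrier
  have hφ0 : ∀ w ∈ upperHalf, 0 ≤ (φ w).re := fun w hw => (abs_nonneg _).trans (hφi w hw)
  set δ : ℝ := 1 / ((φ w₁).re + 1)
  have hδ : 0 < δ := by
    have := hφ0 w₁ hw₁
    positivity
  set ψ : ℂ → ℂ := fun w => (δ : ℂ) * φ w
  have hψre : ∀ w, (ψ w).re = δ * (φ w).re := fun w => by simp [ψ]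
  have hψim : ∀ w, (ψ w).im = δ * (φ w).im := fun w => by simp [ψ]
  have hψi : ∀ w ∈ upperHalf, |(ψ w).im| ≤ (ψ w).re := fun w hw => by
    rw [hψre, hψim, abs_mul, abs_of_pos hδ]
    exact mul_le_mul_of_nonneg_left (hφi w hw) hδ.le
  have hψ0 : ∀ w ∈ upperHalf, 0 ≤ (ψ w).re := fun w hw => (abs_nonneg _).trans (hψi w hw)
  have hψ : ∀ M : ℝ, ∃ a b : ℝ, 0 < a ∧ a < b ∧
      ∀ w ∈ upperHalf, (ψ w).re ≤ M → a ≤ ‖w‖ ∧ ‖w‖ ≤ b := fun M => by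
    obtain ⟨a, b, ha, hab, h⟩ := hφ (M / δ)
    refine ⟨a, b, ha, hab, fun w hw hM => h w hw ?_⟩
    rw [le_div_iff₀ hδ, mul_comm, ← hψre]
    exact hM
  have hw₁1 : (ψ w₁).re < 1 := by
    rw [hψre]
    have := hφ0 w₁ hw₁
    simp only [δ]
    rw [one_div, inv_mul_lt_iff₀ (by linarith)]
    linarith
  set y : Fin N → ℝ := fun j => (z₁ j).im
  have hy : ∀ j, 0 < y j ∧ y j < 1 / 10 := fun j => (hz₁ j).2
  set x : Fin N → ℝ := fun j => (z₁ j).re - (ψ w₁).im * y j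
  have hx : ∀ j, |x j| ≤ 1 / 5 := fun j => by
    have h1 := (hz₁ j).1
    have h2 : |(ψ w₁).im * y j| ≤ 1 * (1 / 10) := by
      rw [abs_mul, abs_of_pos (hy j).1]
      exact mul_le_mul ((hψi w₁ hw₁).trans hw₁1.le) (hy j).2.le (hy j).1.le zero_le_one
    refine (abs_sub _ _).trans ?_
    linarith
  -- `τ = 1 + Re ψ w₁ < 2` and the shift by `Im ψ w₁` make the disc pass through the target
  have hz₁d : disc ψ x y (1 + (ψ w₁).re) w₁ = z₁ := by
    funext j
    apply Complex.ext
    · rw [disc_re]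
      simp [x]
    · rw [disc_im]
      simp [y]
  -- the discs in use have `τ < 2`, so only `Re ψ < 2` matters, which confines `w` to an annulus
  obtain ⟨a, b, ha, -, hab⟩ := hψ 2
  obtain ⟨ε, hε, hthin⟩ := exists_uniform_near_realPolydisk hPD h𝒩 hsub (b := b) ha
  obtain ⟨κ, hκ, hnear⟩ := exists_uniform_near_wedge hPD h𝒩 hsub hy (b := b) ha
  have hΩ : IsOpen (𝒩 ∩ (upperHalf ×ˢ D)) := h𝒩.inter (isOpen_upperHalf.prod hD)
  set θ : ℝ := ε / 3
  obtain ⟨y₀, hy₀, hyy₀⟩ : ∃ y₀ > 0, ∀ j, y₀ ≤ y j := by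
    rcases isEmpty_or_nonempty (Fin N) with h | h
    · exact ⟨1, one_pos, fun j => h.elim j⟩
    · obtain ⟨j, hj⟩ := Finite.exists_min y
      exact ⟨y j, (hy j).1, hj⟩
  set r : ℝ := min (min θ (θ * y₀)) (min (κ / 2) (1 / 10))
  have hθ : 0 < θ := by positivity
  have hr : 0 < r := by positivity
  have hrθ : r ≤ θ := (min_le_left _ _).trans (min_le_left _ _)
  have hrθy : r ≤ θ * y₀ := (min_le_left _ _).trans (min_le_right _ _)
  have hrκ : r ≤ κ / 2 := (min_le_right _ _).trans (min_le_left _ _)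
  have hr10 : r ≤ 1 / 10 := (min_le_right _ _).trans (min_le_right _ _)
  rw [← hz₁d]
  refine disc_mem_rayRegular hΩ hf (hφd.const_mul _) hψ0 (fun M => ?_)
    (fun j => ⟨(hy j).1, (hy j).2.le.trans (by norm_num)⟩) hr hrθ
    (fun j => hrθy.trans (mul_le_mul_of_nonneg_left (hyy₀ j) hθ.le)) hκ ?_ hw₁
    (by linarith) (by linarith)
  · obtain ⟨_, b, _, _, h⟩ := hψ M
    exact ⟨b, fun w hw hM => (h w hw hM).2⟩
  intro w hw τ hwτ hτ hor v hv hpos s hs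
  obtain ⟨hwa, hwb⟩ := hab w hw (by linarith)
  have hs0 : 0 < s := hs.1
  have hψw := hψi w hw
  have hvre : ∀ j, |(v j).re| < r := fun j =>
    ((Complex.abs_re_le_norm _).trans (norm_le_pi_norm v j)).trans_lt hv
  have hvim : ∀ j, |(v j).im| < r := fun j =>
    ((Complex.abs_im_le_norm _).trans (norm_le_pi_norm v j)).trans_lt hv
  have him : ∀ j, ((disc ψ x y τ w + v) j).im = (τ - (ψ w).re) * y j + (v j).im := fun j => by
    rw [Pi.add_apply, Complex.add_im, disc_im]
  have hrex : ∀ j, |x j + (ψ w).im * y j| ≤ 2 / 5 := fun j => by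
    have h2 : |(ψ w).im * y j| ≤ 2 * (1 / 10) := by
      rw [abs_mul, abs_of_pos (hy j).1]
      exact mul_le_mul (by linarith) (hy j).2.le (hy j).1.le (by norm_num)
    refine (abs_add_le _ _).trans ?_
    linarith [hx j]
  have hre : ∀ j, |((disc ψ x y τ w + v) j).re| ≤ 1 / 2 := fun j => by
    rw [Pi.add_apply, Complex.add_re, disc_re]
    refine (abs_add_le _ _).trans ?_
    linarith [hrex j, hvre j]
  have himle : ∀ j, s * ((disc ψ x y τ w + v) j).im ≤ ((disc ψ x y τ w + v) j).im := fun j =>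
    mul_le_of_le_one_left (hpos j).le hs.2
  have hψw0 := hψ0 w hw
  have himle' : ∀ j, ((disc ψ x y τ w + v) j).im < 2 / 5 := fun j => by
    rw [him]
    have h1 : (τ - (ψ w).re) * y j ≤ 2 * (1 / 10) :=
      mul_le_mul (by linarith) (hy j).2.le (hy j).1.le (by norm_num)
    linarith [(abs_lt.1 (hvim j)).2]
  have hray0 : ∀ j, 0 < (ray (disc ψ x y τ w + v) s j).im := fun j => by
    rw [ray_im]
    exact mul_pos hs0 (hpos j)
  have hray1 : ∀ j, |(ray (disc ψ x y τ w + v) s j).re| +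
      (ray (disc ψ x y τ w + v) s j).im < 1 := fun j => by
    rw [ray_re, ray_im]
    linarith [hre j, himle j, himle' j]
  rcases hor with hlow | hlow
  · refine hthin w hw hwa hwb _ hray0 hray1 (fun j => ?_) fun j => ?_
    · rw [ray_re]
      exact hre j
    · rw [ray_im]
      refine (himle j).trans_lt ?_
      rw [him]
      have h1 : (τ - (ψ w).re) * y j ≤ (2 * θ) * 1 :=
        mul_le_mul (by linarith) ((hy j).2.le.trans (by norm_num)) (hy j).1.le (by positivity)
      have h2 := (abs_lt.1 (hvim j)).2
      have h3 : ε = 3 * θ := by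
        simp only [θ]
        ring
      linarith
  · refine hnear w hw hwa hwb hlow _ hray0 hray1 (fun j => x j + (ψ w).im * y j)
      (fun j => (hrex j).trans (by norm_num)) (s * (τ - (ψ w).re)) ⟨?_, ?_⟩ fun j => ?_
    · exact mul_nonneg hs0.le (by linarith)
    · refine (mul_le_of_le_one_left (by linarith) hs.2).trans (by linarith)
    · have h1 : ray (disc ψ x y τ w + v) s j -
          (((x j + (ψ w).im * y j : ℝ) : ℂ) +
            ((s * (τ - (ψ w).re) : ℝ) : ℂ) * (y j : ℂ) * Complex.I) =
          ((v j).re : ℂ) + ((s * (v j).im : ℝ) : ℂ) * Complex.I := by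
        apply Complex.ext
        · rw [Complex.sub_re, ray_re, Pi.add_apply, Complex.add_re, disc_re]
          simp
        · rw [Complex.sub_im, ray_im, him]
          simp
          ring
      rw [h1]
      refine (norm_add_le _ _).trans_lt ?_
      rw [norm_mul, Complex.norm_I, mul_one, Complex.norm_real, Complex.norm_real,
        Real.norm_eq_abs, Real.norm_eq_abs, abs_mul, abs_of_pos hs0]
      have h2 : s * |(v j).im| ≤ |(v j).im| := mul_le_of_le_one_left (abs_nonneg _) hs.2
      linarith [hvre j, hvim j]

theorem agreeNearReal_rayValue (hPD : halfPolydisk N ⊆ D) (hD : IsOpen D) (h𝒩 : IsOpen 𝒩)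
    (hsub : (realPunctured ×ˢ D) ∪ ((closure upperHalf \ {0}) ×ˢ realPolydisk N) ⊆ 𝒩)
    {f : ℂ × (Fin N → ℂ) → ℂ} (hf : DifferentiableOn ℂ f (𝒩 ∩ (upperHalf ×ˢ D))) :
    AgreeNearReal (rayValue f) f (wedgeBox N) := by
  intro x hx z hz
  have hev : ∀ᶠ p in 𝓝 (x, z), ∀ s ∈ Icc (0 : ℝ) 1, (p.1, ray p.2 (s : ℂ)) ∈ 𝒩 := by
    refine isCompact_Icc.eventually_forall_of_forall_eventually fun s hs => ?_
    have h1 : Continuous fun q : (ℂ × (Fin N → ℂ)) × ℝ => (q.1.1, ray q.1.2 (q.2 : ℂ)) :=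
      Continuous.prodMk (by fun_prop)
        (continuous_ray.comp (f := fun q : (ℂ × (Fin N → ℂ)) × ℝ => (q.1.2, (q.2 : ℂ)))
          (by fun_prop))
    refine h1.continuousAt.eventually (h𝒩.mem_nhds (hsub ?_))
    rcases hs.1.eq_or_lt with h0 | h0
    · right
      refine ⟨⟨by rw [closure_upperHalf]; exact hx.1.ge, hx.2⟩, fun j => ⟨?_, ?_⟩⟩
      · have : ray z ((s : ℝ) : ℂ) j = ((z j).re : ℂ) := by simp [ray, ← h0]
        simp only [this]
        rw [Complex.norm_real]
        exact (hz j).1.trans (by norm_num)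
      · simp only
        rw [ray_im, ← h0, zero_mul]
    · left
      refine ⟨hx, hPD (mem_halfPolydisk_of_lt (fun j => ?_) fun j => ?_)⟩
      · simp only
        rw [ray_im]
        exact mul_pos h0 (hz j).2.1
      · simp only
        rw [ray_re, ray_im]
        have := mul_le_of_le_one_left (hz j).2.1.le hs.2
        linarith [(hz j).1, (hz j).2.2]
  filter_upwards [hev, continuous_snd.continuousAt.eventually (isOpen_wedgeBox.mem_nhds hz)]
    with p hp hpz hpU
  refine (continues_of_forall_mem (h𝒩.inter (isOpen_upperHalf.prod hD)) hf
    fun s hs => ⟨hp s ⟨hs.1.le, hs.2⟩, hpU, hPD (mem_halfPolydisk_of_lt (fun j => ?_)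
      fun j => ?_)⟩).rayValue_eq
  · simp only
    rw [ray_im]
    exact mul_pos hs.1 (hpz j).2.1
  · simp only
    rw [ray_re, ray_im]
    have := mul_le_of_le_one_left (hpz j).2.1.le hs.2
    linarith [(hpz j).1, (hpz j).2.2]

end Wedge

/-! ### The identity theorem and conclusion -/

theorem eqOn_of_isPreconnected_of_eventuallyEq {E : Type*} [NormedAddCommGroup E]
    [NormedSpace ℂ E] {Ω : Set E} (hΩ : IsOpen Ω) (hΩc : IsPreconnected Ω) {F f : E → ℂ}
    (hF : DifferentiableOn ℂ F Ω) (hf : DifferentiableOn ℂ f Ω) {p₀ : E} (hp₀ : p₀ ∈ Ω)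
    (h : F =ᶠ[𝓝 p₀] f) : EqOn F f Ω := by
  suffices Ω ⊆ {p | F =ᶠ[𝓝 p] f} from fun p hp => (this hp).self_of_nhds
  refine hΩc.subset_of_closure_inter_subset isOpen_setOfPred_eventually_nhds ⟨p₀, hp₀, h⟩ ?_
  rintro p ⟨hp, hpΩ⟩
  obtain ⟨r, hr, hrΩ⟩ := Metric.isOpen_iff.1 hΩ p hpΩ
  obtain ⟨q, hq, hpq⟩ := Metric.mem_closure_iff.1 hp (r / 2) (by positivity)
  have hsub : ∀ u ∈ ball (0 : E) (r / 2), q + u ∈ Ω := fun u hu => by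
    refine hrΩ (mem_ball.2 ?_)
    have := dist_triangle (q + u) q p
    rw [dist_self_add_left] at this
    rw [dist_comm] at hpq
    linarith [mem_ball_zero_iff.1 hu]
  have hd : ∀ g : E → ℂ, DifferentiableOn ℂ g Ω →
      DifferentiableOn ℂ (fun u => g (q + u)) (ball 0 (r / 2)) := fun g hg =>
    hg.comp (Differentiable.differentiableOn (by fun_prop)) hsub
  have hq' : (fun u => F (q + u)) =ᶠ[𝓝 0] fun u => f (q + u) := by
    have hc : Tendsto (fun u : E => q + u) (𝓝 0) (𝓝 q) := by
      have : Continuous fun u : E => q + u := by fun_prop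
      simpa using this.tendsto 0
    exact hc.eventually hq
  filter_upwards [isOpen_ball.mem_nhds (mem_ball.2 hpq)] with p' hp'
  have hp'' : ‖p' - q‖ < r / 2 := mem_ball_iff_norm.1 hp'
  have h1 := taylorSum_eq hq' (hd f hf) hp''
  have h2 := taylorSum_eq EventuallyEq.rfl (hd F hF) hp''
  simpa using h2.symm.trans h1

/-- A function on `ℂ₊ × D` that agrees with `f` near the punctured real axis is an extension of `f`
from every connected open set on which `f` is holomorphic and that reaches the punctured axis. -/
theorem AgreeNearReal.eqOn {E : Type*} [NormedAddCommGroup E] [NormedSpace ℂ E]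
    {Ω : Set (ℂ × E)} {D : Set E} (hΩ : IsOpen Ω) (hΩc : IsPreconnected Ω)
    (hsub : Ω ⊆ upperHalf ×ˢ D) (hD : D.Nonempty) (hcov : CoversNearReal Ω D)
    {F f : ℂ × E → ℂ} (hF : DifferentiableOn ℂ F (upperHalf ×ˢ D)) (hf : DifferentiableOn ℂ f Ω)
    (hFf : AgreeNearReal F f D) : EqOn F f Ω := by
  obtain ⟨z, hz⟩ := hD
  have h1 : (1 : ℂ) ∈ realPunctured := ⟨by simp, one_ne_zero⟩
  have ht : Tendsto (fun t : ℝ => ((1 : ℂ) + t * Complex.I, z)) (𝓝[>] 0) (𝓝 (1, z)) := by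
    have : Continuous fun t : ℝ => ((1 : ℂ) + t * Complex.I, z) := by fun_prop
    simpa using (this.tendsto 0).mono_left nhdsWithin_le_nhds
  obtain ⟨t, ⟨h2, h3⟩, h4⟩ := ((ht.eventually ((hcov 1 h1 z hz).and
    (hFf 1 h1 z hz).eventually_nhds)).and self_mem_nhdsWithin).exists
  have hU : (1 : ℂ) + t * Complex.I ∈ upperHalf := by simpa [upperHalf] using h4
  refine eqOn_of_isPreconnected_of_eventuallyEq hΩ hΩc (hF.mono hsub) hf (h2 hU) ?_
  filter_upwards [h3, continuous_fst.continuousAt.eventually (isOpen_upperHalf.mem_nhds hU)]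
    with p hp hp' using hp hp'

theorem coversNearReal_of_subset {E : Type*} [NormedAddCommGroup E] {D : Set E} (hD : IsOpen D)
    {𝒩 : Set (ℂ × E)} (h𝒩 : IsOpen 𝒩) (hsub : realPunctured ×ˢ D ⊆ 𝒩) :
    CoversNearReal (𝒩 ∩ (upperHalf ×ˢ D)) D := by
  intro x hx z hz
  filter_upwards [h𝒩.mem_nhds (hsub ⟨hx, hz⟩),
    continuous_snd.continuousAt.eventually (hD.mem_nhds hz)] with p h1 h2 h3
  exact ⟨h1, h3, h2⟩

end AnalyticCompletion

theorem mainTheorem11 (N : ℕ) :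
    (∀ D : Set (Fin N → ℂ), AnalyticCompletion.IsRegion D →
      AnalyticCompletion.halfPolydisk N ⊆ D →
      ∀ 𝒩 : Set (ℂ × (Fin N → ℂ)), IsOpen 𝒩 →
      (AnalyticCompletion.realPunctured ×ˢ D) ∪
        ((closure AnalyticCompletion.upperHalf \ {0}) ×ˢ AnalyticCompletion.realPolydisk N) ⊆ 𝒩 →
      ∀ Ω : Set (ℂ × (Fin N → ℂ)),
      Ω = 𝒩 ∩ (AnalyticCompletion.upperHalf ×ˢ D) →
      AnalyticCompletion.IsRegion Ω →
      AnalyticCompletion.HolomorphicallyExtends Ω (AnalyticCompletion.upperHalf ×ˢ D)) ∧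
    (∀ D' : Set (Fin N → ℂ), AnalyticCompletion.IsRegion D' →
      AnalyticCompletion.unitPolydisk N ⊆ D' →
      ∀ 𝒩' : Set (ℂ × (Fin N → ℂ)), IsOpen 𝒩' →
      AnalyticCompletion.realPunctured ×ˢ D' ⊆ 𝒩' →
      ∀ Ω' : Set (ℂ × (Fin N → ℂ)),
      Ω' = (AnalyticCompletion.upperHalf ×ˢ AnalyticCompletion.unitPolydisk N) ∪
        (𝒩' ∩ (AnalyticCompletion.upperHalf ×ˢ D')) →
      AnalyticCompletion.IsRegion Ω' →
      AnalyticCompletion.HolomorphicallyExtends Ω' (AnalyticCompletion.upperHalf ×ˢ D')) := by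
  open AnalyticCompletion in
  constructor
  · rintro D ⟨hD, hDc⟩ hPD 𝒩 h𝒩 hsub Ω hΩ ⟨hΩo, hΩc⟩
    have hΩsub : Ω ⊆ upperHalf ×ˢ D := by
      rw [hΩ]
      exact Set.inter_subset_right
    refine ⟨hΩsub, fun f hf => ?_⟩
    have hcov : CoversNearReal Ω D := by
      rw [hΩ]
      exact coversNearReal_of_subset hD h𝒩 (Set.subset_union_left.trans hsub)
    have hf' : DifferentiableOn ℂ f (𝒩 ∩ (upperHalf ×ˢ D)) := by rwa [← hΩ]
    obtain ⟨G, hG, hGf⟩ := exists_extension_of_isPreconnected hf hD hDc.isPreconnected hcov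
      isOpen_wedgeBox wedgeBox_nonempty (wedgeBox_subset.trans hPD)
      ((differentiableOn_rayValue f).mono
        (prod_wedgeBox_subset_rayRegular hPD hD h𝒩 hsub hf'))
      (agreeNearReal_rayValue hPD hD h𝒩 hsub hf')
    exact ⟨G, hG, hGf.eqOn hΩo hΩc.isPreconnected hΩsub hDc.nonempty hcov hG hf⟩
  · rintro D ⟨hD, hDc⟩ hQD 𝒩 h𝒩 hsub Ω hΩ ⟨hΩo, hΩc⟩
    have hΩsub : Ω ⊆ upperHalf ×ˢ D := by
      rw [hΩ]
      exact Set.union_subset (Set.prod_mono_right hQD) Set.inter_subset_right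
    have hQΩ : upperHalf ×ˢ unitPolydisk N ⊆ Ω := by
      rw [hΩ]
      exact Set.subset_union_left
    have hQ : IsOpen (unitPolydisk N) := by
      simp only [unitPolydisk, Set.ofPred_forall]
      exact isOpen_iInter_of_finite fun j => isOpen_lt (by fun_prop) continuous_const
    refine ⟨hΩsub, fun f hf => ?_⟩
    have hcov : CoversNearReal Ω D := fun x hx z hz => by
      rw [hΩ]
      filter_upwards [coversNearReal_of_subset hD h𝒩 hsub x hx z hz] with p hp hpU
      exact Or.inr (hp hpU)
    obtain ⟨G, hG, hGf⟩ := exists_extension_of_isPreconnected hf hD hDc.isPreconnected hcov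
      hQ ⟨0, fun j => by simp⟩ hQD (hf.mono hQΩ)
      (fun x _ z _ => Filter.Eventually.of_forall fun p _ => rfl)
    exact ⟨G, hG, hGf.eqOn hΩo hΩc.isPreconnected hΩsub hDc.nonempty hcov hG hf⟩
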